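/- Let $\alpha\in(0,1/2]$ and $\kappa=2^{\alpha-2}$. Let $\Theta=\bigcup_{k\ge 0}\{0,1\}^k$ be the set of finite binary words, $\epsilon$ the empty word, and let $(N_\vartheta)_{\vartheta\in\Theta}$ be independent standard normal random variables on a probability space. For $\vartheta\in\Theta$ and $t\in[0,1]$ put $Z_0^\vartheta(t)=0$ and, for $n\ge 0$, $$Z_{n+1}^\vartheta(t)=\begin{cases}\sqrt{\kappa}\,Z_n^{\vartheta 0}(2t)+N_\vartheta,& 0\le t<1/2,\\ \sqrt{\kappa}\,Z_n^{\vartheta 1}(2t-1)-N_\vartheta,& 1/2\le t\le 1.\end{cases}$$ Let $Z_n=Z_n^\epsilon$ and $Z(t)=\lim_{n\to\infty}Z_n(t)$, where almost surely the convergence holds uniformly in $t\in[0,1]$. Let $S=\sup_{t\in[0,1]}Z(t)$ and $S_n=\sup_{t\in[0,1]}Z_n(t)$. Then $S$ and all the $S_n$ are square integrable, and the following hold. 1. For every $t>0$, $$\mathbb P\big(|S-\mathbb E S|\ge t\big)\le 2\exp\Big(-\frac{1-\kappa}{2}\,t^2\Big),$$ and for every $n\in\mathbb N_0$ the same bound holds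 with $S$ replaced by $S_n$. 2. The constant $(1-\kappa)/2$ in the exponent of the bound for $S$ is asymptotically optimal as $t\to\infty$, that is, $$\lim_{t\to\infty}\frac{\log \mathbb P(|S-\mathbb E S|\ge t)}{t^2}=-\frac{1-\kappa}{2}.$$ 3. $$\frac{\sqrt2}{\sqrt\pi\,(1-\sqrt\kappa)}\le\mathbb E S\le\sqrt{\frac{2}{1-2\kappa}},\qquad \mathrm{Var}(S)\le\frac1{1-\kappa}.$$ For $\alpha=1/2$ the lower bound on $\mathbb E S$ equals $1.968\ldots$ and the upper bound equals $2.613\ldots$. -/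

import Mathlib

namespace MedianFind

/-- The operator `𝔄_u`: `t ↦ 1_{t < u} f (t / u)`. Paths are functions on `ℝ` of which only the
values on `[0, 1]` matter: for `u ∈ (0, 1)` and `t ∈ [0, 1]` only values of `f` on `[0, 1]` are
used. -/
noncomputable def opA (u : ℝ) (f : ℝ → ℝ) (t : ℝ) : ℝ :=
  if t < u then f (t / u) else 0

/-- The operator `𝔅_u`: `t ↦ 1_{t ≥ u} f ((t - u) / (1 - u))`. -/
noncomputable def opB (u : ℝ) (f : ℝ → ℝ) (t : ℝ) : ℝ :=
  if u ≤ t then f ((t - u) / (1 - u)) else 0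

/-- The step function `1_{t < 1/2} - 1_{t ≥ 1/2}`. -/
noncomputable def sg (t : ℝ) : ℝ :=
  if t < 1 / 2 then 1 else -1

/-- `κ = (1/2)^(2 - α)`. -/
noncomputable def kappa (α : ℝ) : ℝ :=
  (1 / 2 : ℝ) ^ (2 - α)

/-- The processes `Z_n^ϑ`, for `n ∈ ℕ` and a node `ϑ` of the complete infinite binary tree. Nodes
are finite words over `{0, 1}`, with `0 = false` and `1 = true`; the children of `ϑ` are `ϑ0` and
`ϑ1`, and the root is the empty word. -/
noncomputable def approxProcess {Ω : Type*} (α : ℝ) (N : List Bool → Ω → ℝ) :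
    ℕ → List Bool → Ω → ℝ → ℝ
  | 0, _, _, _ => 0
  | n + 1, ϑ, ω, t =>
      (1 / 2 : ℝ) ^ (1 - α / 2) * opA (1 / 2) (approxProcess α N n (ϑ ++ [false]) ω) t
        + (1 / 2 : ℝ) ^ (1 - α / 2) * opB (1 / 2) (approxProcess α N n (ϑ ++ [true]) ω) t
        + N ϑ ω * sg t

/-- The process `Z_n = Z_n^ε`. -/
noncomputable def Zn {Ω : Type*} (α : ℝ) (N : List Bool → Ω → ℝ) (n : ℕ) (ω : Ω) (t : ℝ) : ℝ :=
  approxProcess α N n [] ω t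

/-- The limit process `Z(t) = lim_n Z_n(t)` (the limit exists almost surely, uniformly in
`t ∈ [0, 1]`; where it does not exist the value is irrelevant). -/
noncomputable def Z {Ω : Type*} (α : ℝ) (N : List Bool → Ω → ℝ) (ω : Ω) (t : ℝ) : ℝ :=
  Filter.limUnder Filter.atTop (fun n : ℕ => Zn α N n ω t)

/-- `S_n = sup_{t ∈ [0, 1]} Z_n(t)`. -/
noncomputable def Sn {Ω : Type*} (α : ℝ) (N : List Bool → Ω → ℝ) (n : ℕ) (ω : Ω) : ℝ :=
  ⨆ t : Set.Icc (0 : ℝ) 1, Zn α N n ω t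

/-- `S = sup_{t ∈ [0, 1]} Z(t)`. -/
noncomputable def S {Ω : Type*} (α : ℝ) (N : List Bool → Ω → ℝ) (ω : Ω) : ℝ :=
  ⨆ t : Set.Icc (0 : ℝ) 1, Z α N ω t

end MedianFind

/-! Write q = √κ. Splitting the unit interval at 1/2 shows that the supremum obeys S_{n+1} = max(q A
+ X, q B - X), where A and B are the suprema over the two subtrees, X is the variable at the root,
and A, B, X are independent. Everything except the lower tail bound is read off from this recursion.

Concentration rests on a transport inequality in dual (infimum convolution) form: if g(x) ≤ exp(h(y)
+ w(x, y)) for all x, y, then ∫ g ≤ exp(∫ h). For the standard normal law with w = (x - y)²/2 this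
is Talagrand's inequality, `lintegral_gaussianReal_le_exp_integral`. The inequality tensorises
(`InfConvBound.prod`) and passes to images under maps that do not increase the cost
(`InfConvBound.map`). When two maxima are compared, only one of the two branches matters, so the
cost (x - y)²/(2c) for A and B gives (x - y)²/(2(q²c + 1)) for the maximum. The fixed point c = 1/(1
- κ) therefore serves every S_n. Linear h turns it into the exponential moment bound exp(ct²/2),
which survives n → ∞ by Fatou's lemma and yields the tail bounds (Chernoff) and the variance bound
(expansion at t = 0).

The constant is sharp because S ≥ Z(0), and Z(0) = Σ q^k N_{0^k} is centred normal with variance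
exactly 1/(1 - κ).

For the mean, choosing the branch by the sign of X gives E S_{n+1} ≥ q m + E|X| whenever m bounds E
A and E B from below; bounding the square of a maximum by the sum of the squares gives E S_{n+1}² ≤
2(κ M + 1) whenever M bounds E A² and E B², with fixed point 2/(1 - 2κ). -/

namespace MedianFind

open MeasureTheory ProbabilityTheory Filter Topology
open scoped ENNReal NNReal

/-! ### Talagrand's transport inequality for the standard normal law -/

/-- `h` is Lipschitz and is approximated by its tangents `h x + p x * z` up to `M * z ^ 2`. -/
structure QuadApprox (M : ℝ) (h p : ℝ → ℝ) : Prop where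
  lipschitz : ∃ K : ℝ≥0, LipschitzWith K h
  measurable : Measurable p
  bounded : ∃ C, ∀ x, |p x| ≤ C
  approx : ∀ x z, |h (x + z) - h x - p x * z| ≤ M * z ^ 2

lemma integrable_of_lipschitzWith {μ : Measure ℝ} [IsFiniteMeasure μ] (hμ : Integrable id μ)
    {K : ℝ≥0} {h : ℝ → ℝ} (hh : LipschitzWith K h) : Integrable h μ := by
  refine Integrable.mono' (g := fun x => |h 0| + K * |x|) ?_
    hh.continuous.measurable.aestronglyMeasurable ?_
  · exact (integrable_const _).add (hμ.abs.const_mul _)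
  · refine Eventually.of_forall fun x => ?_
    have := hh.dist_le_mul x 0
    rw [Real.dist_eq, Real.dist_eq, sub_zero] at this
    rw [Real.norm_eq_abs]
    have h2 := abs_add_le (h x - h 0) (h 0)
    rw [sub_add_cancel] at h2
    linarith

lemma integrable_id_gaussianReal (m : ℝ) (v : ℝ≥0) : Integrable id (gaussianReal m v) :=
  (memLp_id_gaussianReal 1).integrable (by norm_num)

lemma exp_le_one_add_add_sq_mul_exp_abs (u : ℝ) :
    Real.exp u ≤ 1 + u + u ^ 2 * Real.exp |u| := by
  have h := Complex.norm_exp_sub_sum_le_norm_mul_exp (u : ℂ) 2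
  simp only [Finset.sum_range_succ, Finset.sum_range_zero, Complex.norm_real, Real.norm_eq_abs,
    sq_abs] at h
  have h2 : Complex.exp u
      - (0 + (u : ℂ) ^ 0 / (Nat.factorial 0) + (u : ℂ) ^ 1 / (Nat.factorial 1))
      = ((Real.exp u - 1 - u : ℝ) : ℂ) := by
    push_cast
    simp
    ring
  rw [h2, Complex.norm_real, Real.norm_eq_abs] at h
  have := le_abs_self (Real.exp u - 1 - u)
  linarith

lemma gaussianReal_map_sqrt_mul (s : ℝ≥0) :
    (gaussianReal 0 1).map (fun x => Real.sqrt s * x) = gaussianReal 0 s := by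
  rw [gaussianReal_map_const_mul]
  congr 1
  · simp
  · ext
    simp

lemma integral_gaussianReal_eq_integral_sqrt_mul (s : ℝ≥0) {f : ℝ → ℝ} (hf : Measurable f) :
    ∫ x, f x ∂(gaussianReal 0 s) = ∫ x, f (Real.sqrt s * x) ∂(gaussianReal 0 1) := by
  rw [← gaussianReal_map_sqrt_mul, integral_map (by fun_prop) hf.aestronglyMeasurable]

lemma integrable_gaussianReal_iff_sqrt_mul (s : ℝ≥0) {f : ℝ → ℝ} (hf : Measurable f) :
    Integrable f (gaussianReal 0 s) ↔
      Integrable (fun x => f (Real.sqrt s * x)) (gaussianReal 0 1) := by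
  rw [← gaussianReal_map_sqrt_mul, integrable_map_measure hf.aestronglyMeasurable (by fun_prop)]
  rfl

lemma integrable_exp_sq_div_four_gaussianReal :
    Integrable (fun x => Real.exp (x ^ 2 / 4)) (gaussianReal 0 1) := by
  rw [gaussianReal_of_var_ne_zero _ one_ne_zero,
    integrable_withDensity_iff_integrable_smul' (measurable_gaussianPDF _ _)
      (Eventually.of_forall fun _ => gaussianPDF_lt_top)]
  have := (integrable_exp_neg_mul_sq (b := 1 / 4) (by norm_num)).const_mul
    ((Real.sqrt (2 * Real.pi * (1 : ℝ≥0)))⁻¹)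
  refine this.congr (Eventually.of_forall fun x => ?_)
  simp only [toReal_gaussianPDF, gaussianPDFReal, smul_eq_mul]
  rw [mul_assoc (Real.sqrt _)⁻¹, ← Real.exp_add]
  congr 2
  simp
  ring

lemma integrable_pow_four_mul_exp_gaussianReal :
    Integrable (fun x => x ^ 4 * Real.exp (x ^ 2 / 8)) (gaussianReal 0 1) := by
  refine Integrable.mono' (integrable_exp_sq_div_four_gaussianReal.const_mul 128)
    (by fun_prop) (Eventually.of_forall fun x => ?_)
  rw [Real.norm_of_nonneg (by positivity)]
  have h1 := Real.quadratic_le_exp_of_nonneg (x := x ^ 2 / 8) (by positivity)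
  have h2 : x ^ 4 ≤ 128 * Real.exp (x ^ 2 / 8) := by nlinarith [sq_nonneg x]
  calc x ^ 4 * Real.exp (x ^ 2 / 8) ≤ 128 * Real.exp (x ^ 2 / 8) * Real.exp (x ^ 2 / 8) := by
        gcongr
    _ = 128 * Real.exp (x ^ 2 / 4) := by
        rw [mul_assoc, ← Real.exp_add]; ring_nf

/-- Cameron-Martin shift of a centred Gaussian. -/
lemma lintegral_mul_exp_gaussianReal {s : ℝ≥0} (hs : s ≠ 0) (p : ℝ) {f : ℝ → ℝ≥0∞}
    (hf : Measurable f) :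
    ∫⁻ x, f (x - s * p) * ENNReal.ofReal (Real.exp (p * x - s * p ^ 2 / 2)) ∂(gaussianReal 0 s)
      = ∫⁻ z, f z ∂(gaussianReal 0 s) := by
  have h1 : gaussianReal 0 s = (gaussianReal (s * p) s).map (fun x => x - s * p) := by
    rw [gaussianReal_map_sub_const]; simp
  conv_rhs => rw [h1, lintegral_map hf (by fun_prop)]
  rw [gaussianReal_of_var_ne_zero _ hs, gaussianReal_of_var_ne_zero _ hs,
    lintegral_withDensity_eq_lintegral_mul _ (measurable_gaussianPDF _ _) (by fun_prop),
    lintegral_withDensity_eq_lintegral_mul _ (measurable_gaussianPDF _ _) (by fun_prop)]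
  refine lintegral_congr fun x => ?_
  simp only [Pi.mul_apply, gaussianPDF]
  rw [mul_comm (f _), ← mul_assoc, ← ENNReal.ofReal_mul (gaussianPDFReal_nonneg _ _ _)]
  congr 2
  simp only [gaussianPDFReal]
  rw [mul_assoc, ← Real.exp_add]
  congr 2
  have : (s : ℝ) ≠ 0 := by exact_mod_cast hs
  field_simp
  ring

lemma exists_lintegral_le_of_quadApprox (M : ℝ) :
    ∃ C, 0 ≤ C ∧ ∀ (s : ℝ≥0), 0 < s → M * s ≤ 1 / 8 → ∀ (g : ℝ → ℝ≥0∞) (h p : ℝ → ℝ),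
      QuadApprox M h p →
      (∀ x y, g x ≤ ENNReal.ofReal (Real.exp (h y + (x - y) ^ 2 / (2 * s)))) →
      ∫⁻ x, g x ∂(gaussianReal 0 s)
        ≤ ENNReal.ofReal (Real.exp (∫ x, h x ∂(gaussianReal 0 s) + C * s ^ 2)) := by
  -- The remainder of exp after its linear term is at most M² z⁴ exp(M z²). Rescaling z = √s x and
  -- using M s ≤ 1/8 bounds its integral by s² times this constant, which depends on M alone.
  refine ⟨M ^ 2 * ∫ x, x ^ 4 * Real.exp (x ^ 2 / 8) ∂(gaussianReal 0 1), ?_, ?_⟩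
  · exact mul_nonneg (sq_nonneg _) (integral_nonneg fun x => by positivity)
  intro s hs hMs g h p hh hg
  obtain ⟨K, hK⟩ := hh.lipschitz
  have hs' : (0 : ℝ) < s := by exact_mod_cast hs
  set u : ℝ → ℝ := fun z => h z - h 0 - p 0 * z with hu
  have hum : Measurable u := by
    have := hK.continuous.measurable
    fun_prop
  have hub : ∀ z, |u z| ≤ M * z ^ 2 := fun z => by simpa [hu] using hh.approx 0 z
  have hint : Integrable h (gaussianReal 0 s) :=
    integrable_of_lipschitzWith (integrable_id_gaussianReal 0 s) hK
  have huint : Integrable u (gaussianReal 0 s) :=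
    (hint.sub (integrable_const _)).sub ((integrable_id_gaussianReal 0 s).const_mul _)
  have huI : ∫ z, u z ∂(gaussianReal 0 s) = ∫ z, h z ∂(gaussianReal 0 s) - h 0 := by
    have h3 : ∫ z, p 0 * z ∂(gaussianReal 0 s) = 0 := by
      rw [integral_const_mul, integral_id_gaussianReal, mul_zero]
    have i1 : Integrable (fun z => h z - h 0) (gaussianReal 0 s) :=
      hint.sub (integrable_const _)
    have i2 : Integrable (fun z => p 0 * z) (gaussianReal 0 s) :=
      (integrable_id_gaussianReal 0 s).const_mul _
    simp only [hu]
    rw [integral_sub i1 i2, h3, integral_sub hint (integrable_const _)]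
    simp
  have step1 : ∫⁻ x, g x ∂(gaussianReal 0 s)
      ≤ ∫⁻ z, ENNReal.ofReal (Real.exp (h 0 + u z)) ∂(gaussianReal 0 s) := by
    rw [← lintegral_mul_exp_gaussianReal hs.ne' (p 0)
      (f := fun z => ENNReal.ofReal (Real.exp (h 0 + u z))) (by fun_prop)]
    refine lintegral_mono fun x => ?_
    -- This y minimises the tangent of `h` at 0 plus the quadratic cost; completing the square
    -- produces exactly the Cameron-Martin density.
    refine (hg x (x - s * p 0)).trans ?_
    rw [← ENNReal.ofReal_mul (Real.exp_pos _).le, ← Real.exp_add]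
    refine ENNReal.ofReal_le_ofReal (Real.exp_le_exp.2 (le_of_eq ?_))
    simp only [hu]
    field_simp
    ring
  have hr : Integrable (fun z => z ^ 4 * Real.exp (M * z ^ 2)) (gaussianReal 0 s) ∧
      ∫ z, z ^ 4 * Real.exp (M * z ^ 2) ∂(gaussianReal 0 s)
        ≤ s ^ 2 * ∫ x, x ^ 4 * Real.exp (x ^ 2 / 8) ∂(gaussianReal 0 1) := by
    have hle : ∀ x : ℝ, (Real.sqrt s * x) ^ 4 * Real.exp (M * (Real.sqrt s * x) ^ 2)
        ≤ s ^ 2 * (x ^ 4 * Real.exp (x ^ 2 / 8)) := by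
      intro x
      have e2 : (Real.sqrt s * x) ^ 2 = s * x ^ 2 := by
        rw [mul_pow, Real.sq_sqrt hs'.le]
      have e4 : (Real.sqrt s * x) ^ 4 = s ^ 2 * x ^ 4 := by
        rw [show (4 : ℕ) = 2 * 2 by norm_num, pow_mul, e2]; ring
      rw [e2, e4, mul_assoc]
      gcongr
      nlinarith [sq_nonneg x]
    have hi : Integrable (fun x => (Real.sqrt s * x) ^ 4 * Real.exp (M * (Real.sqrt s * x) ^ 2))
        (gaussianReal 0 1) := by
      refine Integrable.mono' (integrable_pow_four_mul_exp_gaussianReal.const_mul ((s : ℝ) ^ 2))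
        (by fun_prop) (Eventually.of_forall fun x => ?_)
      rw [Real.norm_of_nonneg (by positivity)]
      exact hle x
    refine ⟨(integrable_gaussianReal_iff_sqrt_mul s (by fun_prop)).2 hi, ?_⟩
    rw [integral_gaussianReal_eq_integral_sqrt_mul s (by fun_prop), ← integral_const_mul]
    exact integral_mono hi (integrable_pow_four_mul_exp_gaussianReal.const_mul _) hle
  have hptw : ∀ z, Real.exp (u z) ≤ 1 + u z + M ^ 2 * (z ^ 4 * Real.exp (M * z ^ 2)) := by
    intro z
    have h1 : u z ^ 2 * Real.exp |u z| ≤ (M * z ^ 2) ^ 2 * Real.exp (M * z ^ 2) := by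
      rw [← sq_abs (u z)]
      have := hub z
      gcongr
    have := exp_le_one_add_add_sq_mul_exp_abs (u z)
    nlinarith
  refine step1.trans ?_
  have hI1 : Integrable (fun z => 1 + u z + M ^ 2 * (z ^ 4 * Real.exp (M * z ^ 2)))
      (gaussianReal 0 s) := ((integrable_const _).add huint).add (hr.1.const_mul _)
  calc ∫⁻ z, ENNReal.ofReal (Real.exp (h 0 + u z)) ∂(gaussianReal 0 s)
      ≤ ∫⁻ z, ENNReal.ofReal (Real.exp (h 0)
          * (1 + u z + M ^ 2 * (z ^ 4 * Real.exp (M * z ^ 2)))) ∂(gaussianReal 0 s) := by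
        refine lintegral_mono fun z => ENNReal.ofReal_le_ofReal ?_
        rw [Real.exp_add]
        gcongr
        exact hptw z
    _ = ENNReal.ofReal (∫ z, Real.exp (h 0)
          * (1 + u z + M ^ 2 * (z ^ 4 * Real.exp (M * z ^ 2))) ∂(gaussianReal 0 s)) := by
        rw [ofReal_integral_eq_lintegral_ofReal (hI1.const_mul _)]
        refine Eventually.of_forall fun z => mul_nonneg (Real.exp_pos _).le ?_
        exact (Real.exp_pos _).le.trans (hptw z)
    _ ≤ _ := by
        refine ENNReal.ofReal_le_ofReal ?_
        have i1 : Integrable (fun z => 1 + u z) (gaussianReal 0 s) :=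
          (integrable_const _).add huint
        rw [integral_const_mul, integral_add i1 (hr.1.const_mul _),
          integral_add (integrable_const _) huint, integral_const_mul, huI]
        simp only [integral_const, probReal_univ, one_smul]
        have h5 := mul_le_mul_of_nonneg_left hr.2 (sq_nonneg M)
        rw [show ∫ z, h z ∂(gaussianReal 0 s) +
          M ^ 2 * (∫ x, x ^ 4 * Real.exp (x ^ 2 / 8) ∂(gaussianReal 0 1)) * s ^ 2
          = h 0 + ((∫ z, h z ∂(gaussianReal 0 s) - h 0) +
          M ^ 2 * (s ^ 2 * ∫ x, x ^ 4 * Real.exp (x ^ 2 / 8) ∂(gaussianReal 0 1))) by ring,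
          Real.exp_add]
        gcongr
        refine le_trans ?_ (Real.add_one_le_exp _)
        linarith

lemma integral_add_const_of_isProbabilityMeasure {E : Type*} [MeasurableSpace E] {μ : Measure E}
    [IsProbabilityMeasure μ] {f : E → ℝ} (hf : Integrable f μ) (c : ℝ) :
    ∫ x, (f x + c) ∂μ = ∫ x, f x ∂μ + c := by
  rw [integral_add hf (integrable_const c)]
  simp

lemma QuadApprox.translate_add_const {M : ℝ} {h p : ℝ → ℝ} (hh : QuadApprox M h p) (a c : ℝ) :
    QuadApprox M (fun y => h (a + y) + c) (fun y => p (a + y)) where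
  lipschitz := by
    obtain ⟨K, hK⟩ := hh.lipschitz
    refine ⟨K, LipschitzWith.of_dist_le_mul fun x y => ?_⟩
    simpa using hK.dist_le_mul (a + x) (a + y)
  measurable := hh.measurable.comp (measurable_const_add a)
  bounded := by
    obtain ⟨C, hC⟩ := hh.bounded
    exact ⟨C, fun x => hC _⟩
  approx x z := by
    have := hh.approx (a + x) z
    rwa [← add_assoc, add_sub_add_right_eq_sub]

lemma lipschitzWith_integral_add {ν : Measure ℝ} [IsProbabilityMeasure ν] (hν : Integrable id ν)
    {K : ℝ≥0} {h : ℝ → ℝ} (hK : LipschitzWith K h) :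
    (∀ x, Integrable (fun y => h (x + y)) ν) ∧ LipschitzWith K (fun x => ∫ y, h (x + y) ∂ν) := by
  have hi : ∀ x, Integrable (fun y => h (x + y)) ν := fun x =>
    integrable_of_lipschitzWith (K := K) hν <| LipschitzWith.of_dist_le_mul fun y z => by
      simpa using hK.dist_le_mul (x + y) (x + z)
  refine ⟨hi, LipschitzWith.of_dist_le_mul fun x y => ?_⟩
  rw [Real.dist_eq, ← integral_sub (hi x) (hi y), ← Real.norm_eq_abs]
  refine (norm_integral_le_of_norm_le_const (C := K * dist x y)
    (Eventually.of_forall fun z => ?_)).trans ?_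
  · simpa [Real.dist_eq] using hK.dist_le_mul (x + z) (y + z)
  · simp

lemma QuadApprox.integral_add {M : ℝ} {h p : ℝ → ℝ} (hh : QuadApprox M h p) {ν : Measure ℝ}
    [IsProbabilityMeasure ν] (hν : Integrable id ν) :
    QuadApprox M (fun x => ∫ y, h (x + y) ∂ν) (fun x => ∫ y, p (x + y) ∂ν) := by
  obtain ⟨K, hK⟩ := hh.lipschitz
  obtain ⟨C, hC⟩ := hh.bounded
  have hpm := hh.measurable
  obtain ⟨hi, hL⟩ := lipschitzWith_integral_add hν hK
  have hp : ∀ x, Integrable (fun y => p (x + y)) ν := fun x =>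
    Integrable.mono' (integrable_const C)
      (hpm.comp (measurable_const_add x)).aestronglyMeasurable (Eventually.of_forall fun y => hC _)
  refine ⟨⟨K, hL⟩, ?_, ⟨C, fun x => ?_⟩, fun x z => ?_⟩
  · have : StronglyMeasurable (Function.uncurry fun x y => p (x + y)) :=
      Measurable.stronglyMeasurable (by fun_prop)
    exact this.integral_prod_right.measurable
  · rw [← Real.norm_eq_abs]
    refine (norm_integral_le_of_norm_le_const (C := C)
      (Eventually.of_forall fun z => hC _)).trans ?_
    simp
  · have e : (∫ y, h (x + z + y) ∂ν) - (∫ y, h (x + y) ∂ν) - (∫ y, p (x + y) ∂ν) * z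
        = ∫ y, (h (x + y + z) - h (x + y) - p (x + y) * z) ∂ν := by
      have i0 : Integrable (fun y => h (x + y + z)) ν := by
        simpa only [add_right_comm] using hi (x + z)
      have i1 : Integrable (fun y => h (x + y + z) - h (x + y)) ν := i0.sub (hi x)
      rw [integral_sub i1 ((hp x).mul_const z), integral_sub i0 (hi x), integral_mul_const]
      simp only [add_right_comm]
    rw [e, ← Real.norm_eq_abs]
    refine (norm_integral_le_of_norm_le_const (C := M * z ^ 2)
      (Eventually.of_forall fun y => hh.approx _ _)).trans ?_
    simp

lemma sq_add_div_le {a b x y : ℝ} (ha : 0 < a) (hb : 0 < b) :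
    (x + y) ^ 2 / (2 * (a + b)) ≤ x ^ 2 / (2 * a) + y ^ 2 / (2 * b) := by
  rw [div_add_div _ _ (by positivity) (by positivity), div_le_div_iff₀ (by positivity)
    (by positivity)]
  nlinarith [mul_pos ha hb, sq_nonneg (b * x - a * y)]

/-- A normal variable of variance (k + 1)s is a sum of k + 1 independent ones of variance s, and
each summand costs a factor e^C. For fixed x, x' the last increment is integrated out by `hC`; the
averaged function is again approximated with the same M, so the induction applies to it. -/
lemma lintegral_le_of_quadApprox_nsmul {M C : ℝ} {s : ℝ≥0} (hs : 0 < s)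
    (hC : ∀ (g : ℝ → ℝ≥0∞) (h p : ℝ → ℝ), QuadApprox M h p →
      (∀ x y, g x ≤ ENNReal.ofReal (Real.exp (h y + (x - y) ^ 2 / (2 * s)))) →
      ∫⁻ x, g x ∂(gaussianReal 0 s)
        ≤ ENNReal.ofReal (Real.exp (∫ x, h x ∂(gaussianReal 0 s) + C)))
    (k : ℕ) : ∀ (g : ℝ → ℝ≥0∞) (h p : ℝ → ℝ), Measurable g → QuadApprox M h p →
      (∀ x y, g x ≤ ENNReal.ofReal (Real.exp (h y + (x - y) ^ 2 / (2 * ((k + 1) * s))))) →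
      ∫⁻ x, g x ∂(gaussianReal 0 ((k + 1) * s))
        ≤ ENNReal.ofReal (Real.exp (∫ x, h x ∂(gaussianReal 0 ((k + 1) * s)) + (k + 1) * C)) := by
  have hs' : (0 : ℝ) < s := by exact_mod_cast hs
  induction k with
  | zero =>
    intro g h p _ hh hg
    simpa using hC g h p hh (by simpa using hg)
  | succ k ih =>
    intro g h p hgm hh hg
    obtain ⟨K, hK⟩ := hh.lipschitz
    have hν := integrable_id_gaussianReal 0 s
    have hconv : gaussianReal 0 (((k + 1 : ℕ) + 1) * s)
        = gaussianReal 0 ((k + 1) * s) ∗ gaussianReal 0 s := by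
      rw [gaussianReal_conv_gaussianReal]
      congr 1
      · simp
      · push_cast; ring
    have hhi : Integrable h (gaussianReal 0 ((k + 1) * s) ∗ gaussianReal 0 s) := by
      rw [← hconv]
      exact integrable_of_lipschitzWith (integrable_id_gaussianReal _ _) hK
    have hH := (hh.integral_add hν).translate_add_const 0 C
    simp only [zero_add] at hH
    rw [hconv, Measure.lintegral_conv hgm, integral_conv hhi]
    refine (ih _ _ _ ?_ hH fun x x' => ?_).trans (le_of_eq ?_)
    · exact Measurable.lintegral_prod_right' (f := fun q : ℝ × ℝ => g (q.1 + q.2)) (by fun_prop)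
    · refine (hC _ _ _ (hh.translate_add_const x' ((x - x') ^ 2 / (2 * ((k + 1) * s))))
        fun y y' => ?_).trans (le_of_eq ?_)
      · refine (hg (x + y) (x' + y')).trans (ENNReal.ofReal_le_ofReal (Real.exp_le_exp.2 ?_))
        have := sq_add_div_le (a := (k + 1) * s) (b := s) (x := x - x') (y := y - y')
          (by positivity) hs'
        push_cast
        rw [show ((k : ℝ) + 1 + 1) * s = (k + 1) * s + s by ring,
          show x + y - (x' + y') = x - x' + (y - y') by ring]
        linarith
      · rw [integral_add_const_of_isProbabilityMeasure ((lipschitzWith_integral_add hν hK).1 x')]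
        congr 2
        ring
    · rw [integral_add_const_of_isProbabilityMeasure
        (integrable_of_lipschitzWith (integrable_id_gaussianReal _ _)
          (lipschitzWith_integral_add hν hK).2)]
      congr 2
      push_cast
      ring

lemma lintegral_gaussianReal_le_of_quadApprox {M : ℝ} {g : ℝ → ℝ≥0∞} {h p : ℝ → ℝ}
    (hg : Measurable g) (hh : QuadApprox M h p)
    (hgh : ∀ x y, g x ≤ ENNReal.ofReal (Real.exp (h y + (x - y) ^ 2 / 2))) :
    ∫⁻ x, g x ∂(gaussianReal 0 1) ≤ ENNReal.ofReal (Real.exp (∫ x, h x ∂(gaussianReal 0 1))) := by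
  obtain ⟨C, hC0, hC⟩ := exists_lintegral_le_of_quadApprox M
  have hlim : Tendsto (fun k : ℕ => ENNReal.ofReal (Real.exp
      (∫ x, h x ∂(gaussianReal 0 1) + C * (1 / ((k : ℝ) + 1))))) atTop
      (𝓝 (ENNReal.ofReal (Real.exp (∫ x, h x ∂(gaussianReal 0 1) + C * 0)))) := by
    refine ENNReal.tendsto_ofReal ((Real.continuous_exp.tendsto _).comp ?_)
    exact (tendsto_one_div_add_atTop_nhds_zero_nat.const_mul C).const_add _
  rw [mul_zero, add_zero] at hlim
  refine ge_of_tendsto hlim ?_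
  have hsmall : ∀ᶠ k : ℕ in atTop, M * (1 / ((k : ℝ) + 1)) < 1 / 8 := by
    have := (tendsto_one_div_add_atTop_nhds_zero_nat (𝕜 := ℝ)).const_mul M
    rw [mul_zero] at this
    exact this.eventually_lt_const (by norm_num)
  filter_upwards [hsmall] with k hk
  -- With k + 1 increments of this variance the total error is (k + 1) C s² = C/(k + 1), which
  -- vanishes in the limit.
  set s : ℝ≥0 := 1 / ((k : ℝ≥0) + 1) with hsdef
  have hs : 0 < s := by positivity
  have hsc : (s : ℝ) = 1 / ((k : ℝ) + 1) := by simp [hsdef]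
  have hks : ((k : ℝ≥0) + 1) * s = 1 := by rw [hsdef]; field_simp
  have hks' : ((k : ℝ) + 1) * s = 1 := by exact_mod_cast hks
  have := lintegral_le_of_quadApprox_nsmul hs
    (fun g h p => hC s hs (by rw [hsc]; exact hk.le) g h p) k g h p hg hh (by
      rw [hks']; simpa using hgh)
  rw [hks] at this
  refine this.trans (le_of_eq ?_)
  rw [hsc]
  congr 3
  field_simp

/-- The moving average is differentiable, and its derivative, a difference quotient of `h`, has
Lipschitz constant 2K/δ. This smooths an arbitrary Lipschitz function. -/
lemma quadApprox_average {K : ℝ≥0} {h : ℝ → ℝ} (hK : LipschitzWith K h) {δ : ℝ} (hδ : 0 < δ) :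
    QuadApprox (2 * K / δ) (fun x => (∫ t in x..(x + δ), h t) / δ)
      (fun x => (h (x + δ) - h x) / δ) := by
  have hc := hK.continuous
  have hder : ∀ x,
      HasDerivAt (fun x => (∫ t in x..(x + δ), h t) / δ) ((h (x + δ) - h x) / δ) x := by
    intro x
    have hF : ∀ x, HasDerivAt (fun x => ∫ t in (0 : ℝ)..x, h t) (h x) x := fun x =>
      intervalIntegral.integral_hasDerivAt_right (hc.intervalIntegrable _ _)
        (hc.stronglyMeasurableAtFilter _ _) hc.continuousAt
    have h1 := (((hF (x + δ)).comp_add_const x δ).sub (hF x)).div_const δ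
    convert! h1 using 2 with y
    simp only [Pi.sub_apply]
    rw [intervalIntegral.integral_interval_sub_left (hc.intervalIntegrable _ _)
      (hc.intervalIntegrable _ _)]
  have hb : ∀ x, |(h (x + δ) - h x) / δ| ≤ K := by
    intro x
    rw [abs_div, abs_of_pos hδ, div_le_iff₀ hδ]
    simpa [Real.dist_eq, abs_of_pos hδ] using hK.dist_le_mul (x + δ) x
  refine ⟨⟨K, lipschitzWith_of_nnnorm_deriv_le (fun x => (hder x).differentiableAt) fun x => ?_⟩,
    ?_, ⟨K, hb⟩, fun x z => ?_⟩
  · rw [(hder x).deriv]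
    exact_mod_cast hb x
  · have := hc.measurable
    fun_prop
  · have hd : ∀ w ∈ Set.uIcc 0 z, HasDerivWithinAt
        (fun w => (∫ t in (x + w)..(x + w + δ), h t) / δ - (h (x + δ) - h x) / δ * w)
        ((h (x + w + δ) - h (x + w)) / δ - (h (x + δ) - h x) / δ) (Set.uIcc 0 z) w := by
      intro w _
      have h1 := (hder (x + w)).comp_const_add x w
      have h2 := (hasDerivAt_id w).const_mul ((h (x + δ) - h x) / δ)
      rw [mul_one] at h2
      exact (h1.sub h2).hasDerivWithinAt
    have hbd : ∀ w ∈ Set.uIcc 0 z,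
        ‖(h (x + w + δ) - h (x + w)) / δ - (h (x + δ) - h x) / δ‖ ≤ 2 * K / δ * |z| := by
      intro w hw
      have hwz : |w| ≤ |z| := by
        have := Set.abs_sub_left_of_mem_uIcc hw
        simpa using this
      have e1 := hK.dist_le_mul (x + w + δ) (x + δ)
      have e2 := hK.dist_le_mul (x + w) x
      simp only [Real.dist_eq] at e1 e2
      rw [show x + w + δ - (x + δ) = w by ring] at e1
      rw [show x + w - x = w by ring] at e2
      rw [← sub_div, Real.norm_eq_abs, abs_div, abs_of_pos hδ, div_mul_eq_mul_div]
      gcongr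
      rw [show h (x + w + δ) - h (x + w) - (h (x + δ) - h x)
        = (h (x + w + δ) - h (x + δ)) - (h (x + w) - h x) by ring]
      have := mul_le_mul_of_nonneg_left hwz K.2
      refine (abs_sub _ _).trans ?_
      simp only [NNReal.val_eq_coe] at this
      linarith
    have := (convex_uIcc (0 : ℝ) z).norm_image_sub_le_of_norm_hasDerivWithin_le hd hbd
      Set.left_mem_uIcc Set.right_mem_uIcc
    simp only [add_zero, mul_zero, sub_zero, Real.norm_eq_abs] at this
    rw [mul_assoc, abs_mul_abs_self, ← pow_two, sub_right_comm] at this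
    exact this

lemma abs_average_sub_le {K : ℝ≥0} {h : ℝ → ℝ} (hK : LipschitzWith K h) {δ : ℝ} (hδ : 0 < δ)
    (x : ℝ) : |(∫ t in x..(x + δ), h t) / δ - h x| ≤ K * δ := by
  have e : (∫ t in x..(x + δ), h t) / δ - h x = (∫ t in x..(x + δ), (h t - h x)) / δ := by
    rw [intervalIntegral.integral_sub (hK.continuous.intervalIntegrable _ _) (by simp),
      intervalIntegral.integral_const]
    simp
    field_simp
  rw [e, abs_div, abs_of_pos hδ, div_le_iff₀ hδ, ← Real.norm_eq_abs]
  have := intervalIntegral.norm_integral_le_of_norm_le_const (a := x) (b := x + δ)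
    (f := fun t => h t - h x) (C := K * δ) fun t ht => by
      rw [Set.uIoc_of_le (by linarith)] at ht
      refine (hK.dist_le_mul t x).trans ?_
      rw [Real.dist_eq, abs_of_nonneg (by linarith [ht.1])]
      gcongr
      linarith [ht.2]
  simpa [abs_of_pos hδ] using this

/-- The dual form of Talagrand's transport inequality for the standard normal distribution. -/
theorem lintegral_gaussianReal_le_exp_integral {K : ℝ≥0} {g : ℝ → ℝ≥0∞} {h : ℝ → ℝ}
    (hg : Measurable g) (hK : LipschitzWith K h)
    (hgh : ∀ x y, g x ≤ ENNReal.ofReal (Real.exp (h y + (x - y) ^ 2 / 2))) :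
    ∫⁻ x, g x ∂(gaussianReal 0 1) ≤ ENNReal.ofReal (Real.exp (∫ x, h x ∂(gaussianReal 0 1))) := by
  have hlim : Tendsto (fun δ : ℝ => ENNReal.ofReal (Real.exp
      (∫ x, h x ∂(gaussianReal 0 1) + 2 * K * δ))) (𝓝[>] 0)
      (𝓝 (ENNReal.ofReal (Real.exp (∫ x, h x ∂(gaussianReal 0 1) + 2 * K * 0)))) := by
    refine ENNReal.tendsto_ofReal (Tendsto.mono_left ?_ nhdsWithin_le_nhds)
    exact Continuous.tendsto (by fun_prop) _
  rw [mul_zero, add_zero] at hlim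
  refine ge_of_tendsto hlim ?_
  filter_upwards [self_mem_nhdsWithin] with δ hδ
  rw [Set.mem_Ioi] at hδ
  -- The average is within Kδ of `h`. Raising it by Kδ puts it above `h`, so the hypothesis on `g`
  -- persists, at a total loss of 2Kδ in the mean.
  have hq := (quadApprox_average hK hδ).translate_add_const 0 (K * δ)
  simp only [zero_add] at hq
  obtain ⟨K', hK'⟩ := hq.lipschitz
  refine (lintegral_gaussianReal_le_of_quadApprox hg hq fun x y => ?_).trans ?_
  · refine (hgh x y).trans (ENNReal.ofReal_le_ofReal (Real.exp_le_exp.2 ?_))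
    have := (abs_le.1 (abs_average_sub_le hK hδ y)).1
    linarith
  · refine ENNReal.ofReal_le_ofReal (Real.exp_le_exp.2 ?_)
    have hi := integrable_of_lipschitzWith (integrable_id_gaussianReal 0 1) hK
    rw [← integral_add_const_of_isProbabilityMeasure hi]
    refine integral_mono (integrable_of_lipschitzWith (integrable_id_gaussianReal 0 1) hK')
      (hi.add (integrable_const _)) fun x => ?_
    have := (abs_le.1 (abs_average_sub_le hK hδ x)).2
    simp only
    linarith

/-! ### Products and images of transport inequalities -/

section InfConv

variable {E F : Type*} [PseudoMetricSpace E] [MeasurableSpace E] [PseudoMetricSpace F]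
  [MeasurableSpace F]

/-- The dual form of a transport-entropy inequality for `μ` with cost function `w`. -/
structure InfConvBound (μ : Measure E) (w : E → E → ℝ) : Prop where
  integrable : ∀ (K : ℝ≥0) (h : E → ℝ), LipschitzWith K h → Integrable h μ
  lintegral_le : ∀ (K : ℝ≥0) (g : E → ℝ≥0∞) (h : E → ℝ), Measurable g → LipschitzWith K h →
    (∀ x y, g x ≤ ENNReal.ofReal (Real.exp (h y + w x y))) →
    ∫⁻ x, g x ∂μ ≤ ENNReal.ofReal (Real.exp (∫ x, h x ∂μ))

lemma InfConvBound.gaussianReal :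
    InfConvBound (gaussianReal 0 1) (fun x y => (x - y) ^ 2 / 2) where
  integrable _ _ hK := integrable_of_lipschitzWith (integrable_id_gaussianReal 0 1) hK
  lintegral_le _ _ _ hg hK hgh := lintegral_gaussianReal_le_exp_integral hg hK hgh

/-- Test functions are pulled back along φ; the Lipschitz condition on φ only keeps them Lipschitz.
-/
lemma InfConvBound.map {μ : Measure E} {w : E → E → ℝ} (hμ : InfConvBound μ w)
    {v : F → F → ℝ} {φ : E → F} {L : ℝ≥0} (hφ : LipschitzWith L φ) (hφm : Measurable φ)
    [OpensMeasurableSpace F] (hvw : ∀ x y, v (φ x) (φ y) ≤ w x y) :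
    InfConvBound (μ.map φ) v where
  integrable K h hK := by
    rw [integrable_map_measure hK.continuous.measurable.aestronglyMeasurable hφm.aemeasurable]
    exact hμ.integrable _ _ (hK.comp hφ)
  lintegral_le K g h hg hK hgh := by
    rw [lintegral_map hg hφm,
      integral_map hφm.aemeasurable hK.continuous.measurable.aestronglyMeasurable]
    refine hμ.lintegral_le _ _ _ (hg.comp hφm) (hK.comp hφ) fun x y =>
      (hgh (φ x) (φ y)).trans (ENNReal.ofReal_le_ofReal (Real.exp_le_exp.2 ?_))
    simpa using hvw x y

/-- For fixed x, x', the inequality for ν applied to h(x', ·) + w x x' bounds the inner integral of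
g(x, ·). The outcome is precisely the hypothesis of the inequality for μ, with the partial integral
of `h` as test function. -/
lemma InfConvBound.prod [OpensMeasurableSpace (E × F)]
    {μ : Measure E} {ν : Measure F} [IsProbabilityMeasure μ] [IsProbabilityMeasure ν]
    {w : E → E → ℝ} {v : F → F → ℝ} (hμ : InfConvBound μ w) (hν : InfConvBound ν v) :
    InfConvBound (μ.prod ν) (fun x y => w x.1 y.1 + v x.2 y.2) := by
  have hint : ∀ (K : ℝ≥0) (h : E × F → ℝ), LipschitzWith K h → Integrable h (μ.prod ν) := by
    intro K h hK
    obtain ⟨x₀⟩ : Nonempty E := nonempty_of_isProbabilityMeasure μ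
    obtain ⟨y₀⟩ : Nonempty F := nonempty_of_isProbabilityMeasure ν
    have i1 : Integrable (fun z : E × F => dist z.1 x₀) (μ.prod ν) :=
      (hμ.integrable 1 (fun x => dist x x₀) (LipschitzWith.dist_left x₀)).comp_fst ν
    have i2 : Integrable (fun z : E × F => dist z.2 y₀) (μ.prod ν) :=
      (hν.integrable 1 (fun y => dist y y₀) (LipschitzWith.dist_left y₀)).comp_snd μ
    refine Integrable.mono' ((integrable_const |h (x₀, y₀)|).add ((i1.add i2).const_mul K))
      hK.continuous.measurable.aestronglyMeasurable (Eventually.of_forall fun z => ?_)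
    have h1 := hK.dist_le_mul z (x₀, y₀)
    rw [Real.dist_eq, Prod.dist_eq] at h1
    have h2 := abs_add_le (h z - h (x₀, y₀)) (h (x₀, y₀))
    rw [sub_add_cancel] at h2
    have h3 : max (dist z.1 x₀) (dist z.2 y₀) ≤ dist z.1 x₀ + dist z.2 y₀ :=
      max_le_add_of_nonneg dist_nonneg dist_nonneg
    have h4 := mul_le_mul_of_nonneg_left h3 K.2
    simp only [NNReal.val_eq_coe] at h4
    simp only [Pi.add_apply, Real.norm_eq_abs]
    linarith
  refine ⟨hint, fun K g h hg hK hgh => ?_⟩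
  have hsec : ∀ x, LipschitzWith K (fun y => h (x, y)) := fun x =>
    LipschitzWith.of_dist_le_mul fun y y' => by
      simpa [Prod.dist_eq] using hK.dist_le_mul (x, y) (x, y')
  have hi : ∀ x, Integrable (fun y => h (x, y)) ν := fun x => hν.integrable K _ (hsec x)
  rw [lintegral_prod _ hg.aemeasurable, integral_prod _ (hint K h hK)]
  refine hμ.lintegral_le K _ _ hg.lintegral_prod_right' ?_ fun x x' => ?_
  · refine LipschitzWith.of_dist_le_mul fun x x' => ?_
    rw [Real.dist_eq, ← integral_sub (hi x) (hi x'), ← Real.norm_eq_abs]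
    refine (norm_integral_le_of_norm_le_const (C := K * dist x x')
      (Eventually.of_forall fun y => ?_)).trans (by simp)
    simpa [Real.dist_eq, Prod.dist_eq] using hK.dist_le_mul (x, y) (x', y)
  · rw [← integral_add_const_of_isProbabilityMeasure (hi x')]
    refine hν.lintegral_le K _ (fun y => h (x', y) + w x x') (hg.comp measurable_prodMk_left)
      ?_ fun y y' => ?_
    · exact LipschitzWith.of_dist_le_mul fun y y' => by simpa using (hsec x').dist_le_mul y y'
    · refine (hgh (x, y) (x', y')).trans (le_of_eq ?_)
      simp only [add_assoc]

end InfConv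

/-- Cauchy-Schwarz with weights q²c and 1. -/
lemma sq_mul_add_div_le {q c a x : ℝ} (hq : 0 < q) (hc : 0 < c) :
    (q * a + x) ^ 2 / (2 * (q ^ 2 * c + 1)) ≤ a ^ 2 / (2 * c) + x ^ 2 / 2 := by
  refine (sq_add_div_le (a := q ^ 2 * c) (b := 1) (by positivity) one_pos).trans (le_of_eq ?_)
  field_simp

/-- The difference of two maxima is at most the larger of the two branchwise differences, so only
one of a - a' and b - b' enters. Hence the new constant contains q²c and not 2q²c. -/
lemma sq_max_sub_max_div_le {q c : ℝ} (hq : 0 < q) (hc : 0 < c) (a b x a' b' x' : ℝ) :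
    (max (q * a + x) (q * b - x) - max (q * a' + x') (q * b' - x')) ^ 2 / (2 * (q ^ 2 * c + 1))
      ≤ (a - a') ^ 2 / (2 * c) + ((b - b') ^ 2 / (2 * c) + (x - x') ^ 2 / 2) := by
  have h0 := abs_max_sub_max_le_max (q * a + x) (q * b - x) (q * a' + x') (q * b' - x')
  have ha : 0 ≤ (a - a') ^ 2 / (2 * c) := by positivity
  have hb : 0 ≤ (b - b') ^ 2 / (2 * c) := by positivity
  rcases le_max_iff.1 h0 with h | h
  · have h1 := sq_mul_add_div_le (a := a - a') (x := x - x') hq hc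
    have h2 := div_le_div_of_nonneg_right (sq_le_sq.2 h)
      (by positivity : (0 : ℝ) ≤ 2 * (q ^ 2 * c + 1))
    rw [show q * a + x - (q * a' + x') = q * (a - a') + (x - x') by ring] at h2
    linarith
  · have h1 := sq_mul_add_div_le (a := b - b') (x := -(x - x')) hq hc
    have h2 := div_le_div_of_nonneg_right (sq_le_sq.2 h)
      (by positivity : (0 : ℝ) ≤ 2 * (q ^ 2 * c + 1))
    rw [show q * b - x - (q * b' - x') = q * (b - b') + -(x - x') by ring] at h2
    rw [neg_sq] at h1
    linarith

lemma lipschitzWith_max_affine (q : ℝ) :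
    ∃ L : ℝ≥0, LipschitzWith L
      (fun z : ℝ × ℝ × ℝ => max (q * z.1 + z.2.2) (q * z.2.1 - z.2.2)) := by
  refine ⟨Real.toNNReal (|q| + 1), LipschitzWith.of_dist_le_mul fun y z => ?_⟩
  rw [Real.coe_toNNReal _ (by positivity), Real.dist_eq]
  refine (abs_max_sub_max_le_max _ _ _ _).trans ?_
  have h1 : |y.1 - z.1| ≤ dist y z := by
    rw [← Real.dist_eq, Prod.dist_eq]; exact le_max_left _ _
  have h2 : |y.2.1 - z.2.1| ≤ dist y z := by
    rw [← Real.dist_eq, Prod.dist_eq, Prod.dist_eq]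
    exact (le_max_left _ _).trans (le_max_right _ _)
  have h3 : |y.2.2 - z.2.2| ≤ dist y z := by
    rw [← Real.dist_eq, Prod.dist_eq, Prod.dist_eq]
    exact (le_max_right _ _).trans (le_max_right _ _)
  have hq := abs_nonneg q
  refine max_le ?_ ?_
  · rw [show q * y.1 + y.2.2 - (q * z.1 + z.2.2) = q * (y.1 - z.1) + (y.2.2 - z.2.2) by ring]
    refine (abs_add_le _ _).trans ?_
    rw [abs_mul]
    nlinarith
  · rw [show q * y.2.1 - y.2.2 - (q * z.2.1 - z.2.2)
      = q * (y.2.1 - z.2.1) - (y.2.2 - z.2.2) by ring]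
    refine (abs_sub _ _).trans ?_
    rw [abs_mul]
    nlinarith

/-- The quadratic bound for `max (q A + X) (q B - X)`, with `A`, `B`, `X` independent and `X`
standard normal. -/
lemma InfConvBound.map_max {μ ν : Measure ℝ} [IsProbabilityMeasure μ] [IsProbabilityMeasure ν]
    {q c : ℝ} (hq : 0 < q) (hc : 0 < c)
    (hμ : InfConvBound μ (fun x y => (x - y) ^ 2 / (2 * c)))
    (hν : InfConvBound ν (fun x y => (x - y) ^ 2 / (2 * c))) :
    InfConvBound ((μ.prod (ν.prod (ProbabilityTheory.gaussianReal 0 1))).map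
      (fun z : ℝ × ℝ × ℝ => max (q * z.1 + z.2.2) (q * z.2.1 - z.2.2)))
      (fun x y => (x - y) ^ 2 / (2 * (q ^ 2 * c + 1))) := by
  obtain ⟨L, hL⟩ := lipschitzWith_max_affine q
  exact (hμ.prod (hν.prod InfConvBound.gaussianReal)).map hL hL.continuous.measurable
    fun y z => sq_max_sub_max_div_le hq hc _ _ _ _ _ _

/-- The infimum over y of ty + (x - y)²/(2c) is tx - ct²/2, attained at y = x - ct. -/
lemma InfConvBound.lintegral_exp_le {μ : Measure ℝ} {c : ℝ} (hc : 0 < c)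
    (hμ : InfConvBound μ (fun x y => (x - y) ^ 2 / (2 * c))) (t : ℝ) :
    ∫⁻ x, ENNReal.ofReal (Real.exp (t * (x - ∫ y, y ∂μ))) ∂μ
      ≤ ENNReal.ofReal (Real.exp (c * t ^ 2 / 2)) := by
  have hL : LipschitzWith (Real.toNNReal |t|) (fun x : ℝ => t * x) :=
    LipschitzWith.of_dist_le_mul fun x y => by
      rw [Real.coe_toNNReal _ (abs_nonneg _), Real.dist_eq, Real.dist_eq, ← mul_sub, abs_mul]
  have h := hμ.lintegral_le _ (fun x => ENNReal.ofReal (Real.exp (t * x - c * t ^ 2 / 2))) _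
    (by fun_prop) hL fun x y => by
      refine ENNReal.ofReal_le_ofReal (Real.exp_le_exp.2 ?_)
      have : 0 ≤ (x - y - c * t) ^ 2 / (2 * c) := by positivity
      have e : (x - y - c * t) ^ 2 / (2 * c)
          = (x - y) ^ 2 / (2 * c) - t * (x - y) + c * t ^ 2 / 2 := by
        field_simp
        ring
      rw [e] at this
      linarith
  rw [integral_const_mul] at h
  have e : ∀ x, ENNReal.ofReal (Real.exp (t * (x - ∫ y, y ∂μ)))
      = ENNReal.ofReal (Real.exp (c * t ^ 2 / 2 - t * ∫ y, y ∂μ))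
        * ENNReal.ofReal (Real.exp (t * x - c * t ^ 2 / 2)) := by
    intro x
    rw [← ENNReal.ofReal_mul (Real.exp_pos _).le, ← Real.exp_add]
    ring_nf
  simp_rw [e]
  rw [lintegral_const_mul _ (by fun_prop)]
  refine (mul_le_mul_right h _).trans (le_of_eq ?_)
  rw [← ENNReal.ofReal_mul (Real.exp_pos _).le, ← Real.exp_add]
  ring_nf

/-! ### Tails and second moments from exponential moments -/

section SubGaussian

variable {Ω : Type*} [MeasurableSpace Ω] {P : Measure Ω}

/-- A bound on the lower integral contains integrability, and it is the form that Fatou's lemma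
delivers. -/
lemma hasSubgaussianMGF_of_lintegral_exp_le {X : Ω → ℝ} (hX : AEMeasurable X P) {c : ℝ≥0}
    (h : ∀ t : ℝ, ∫⁻ ω, ENNReal.ofReal (Real.exp (t * X ω)) ∂P
      ≤ ENNReal.ofReal (Real.exp (c * t ^ 2 / 2))) : HasSubgaussianMGF X c P where
  integrable_exp_mul t := by
    refine ⟨AEMeasurable.aestronglyMeasurable (by fun_prop), ?_⟩
    rw [hasFiniteIntegral_iff_ofReal (Eventually.of_forall fun _ => (Real.exp_pos _).le)]
    exact (h t).trans_lt ENNReal.ofReal_lt_top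
  mgf_le t := by
    rw [mgf, integral_eq_lintegral_of_nonneg_ae
      (Eventually.of_forall fun _ => (Real.exp_pos _).le)
      (AEMeasurable.aestronglyMeasurable (by fun_prop))]
    exact ENNReal.toReal_le_of_le_ofReal (Real.exp_pos _).le (h t)

lemma measure_abs_ge_le_of_hasSubgaussianMGF [IsProbabilityMeasure P] {X : Ω → ℝ} {c : ℝ≥0}
    (h : HasSubgaussianMGF X c P) {t : ℝ} (ht : 0 ≤ t) :
    P.real {ω | t ≤ |X ω|} ≤ 2 * Real.exp (-t ^ 2 / (2 * c)) := by
  have h1 := h.measure_ge_le ht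
  have h2 := h.neg.measure_ge_le ht
  have hsub : {ω | t ≤ |X ω|} ⊆ {ω | t ≤ X ω} ∪ {ω | t ≤ (-X) ω} := fun ω hω => by
    simpa [le_abs] using hω
  refine (measureReal_mono hsub).trans ((measureReal_union_le _ _).trans ?_)
  linarith

lemma one_add_sq_div_two_le_cosh (u : ℝ) : 1 + u ^ 2 / 2 ≤ Real.cosh u := by
  have h1 : Real.cosh u = 1 + 2 * Real.sinh (u / 2) ^ 2 := by
    have h := Real.cosh_two_mul (u / 2)
    rw [Real.cosh_sq, mul_div_cancel₀ u two_ne_zero] at h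
    linarith
  have h2 : (u / 2) ^ 2 ≤ Real.sinh (u / 2) ^ 2 := by
    rw [sq_le_sq, Real.abs_sinh]
    exact Real.self_le_sinh_iff.2 (abs_nonneg _)
  rw [h1]
  linarith

/-- Integrating 1 + (tX)²/2 ≤ cosh(tX) gives E X² ≤ (exp(ct²/2) - 1)/(t²/2), and the right side
tends to c as t decreases to 0. -/
lemma integral_sq_le_of_hasSubgaussianMGF {X : Ω → ℝ} {c : ℝ≥0} [IsProbabilityMeasure P]
    (h : HasSubgaussianMGF X c P) : ∫ ω, X ω ^ 2 ∂P ≤ c := by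
  have hi : Integrable (fun ω => X ω ^ 2) P := by
    have := h.memLp 2
    exact (memLp_two_iff_integrable_sq h.aestronglyMeasurable).1 (by exact_mod_cast this)
  have key : ∀ t : ℝ, 0 < t → ∫ ω, X ω ^ 2 ∂P ≤ (Real.exp (c * t ^ 2 / 2) - 1) / (t ^ 2 / 2) := by
    intro t ht
    rw [le_div_iff₀ (by positivity)]
    have h1 : ∀ ω, X ω ^ 2 * (t ^ 2 / 2) + 1
        ≤ (Real.exp (t * X ω) + Real.exp (-t * X ω)) / 2 := by
      intro ω
      rw [neg_mul, ← Real.cosh_eq]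
      have := one_add_sq_div_two_le_cosh (t * X ω)
      nlinarith
    have i1 := h.integrable_exp_mul t
    have i2 := h.integrable_exp_mul (-t)
    have h2 := integral_mono ((hi.mul_const (t ^ 2 / 2)).add (integrable_const 1))
      ((i1.add i2).div_const 2) h1
    have e1 : ∫ ω, (Real.exp (t * X ω) + Real.exp (-t * X ω)) / 2 ∂P
        = (mgf X P t + mgf X P (-t)) / 2 := by
      rw [integral_div, integral_add i1 i2]; rfl
    have e2 : ∫ ω, (X ω ^ 2 * (t ^ 2 / 2) + 1) ∂P = (∫ ω, X ω ^ 2 ∂P) * (t ^ 2 / 2) + 1 := by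
      rw [integral_add_const_of_isProbabilityMeasure (hi.mul_const _), integral_mul_const]
    have m1 := h.mgf_le t
    have m2 := h.mgf_le (-t)
    rw [neg_sq] at m2
    simp only [Pi.add_apply] at h2
    rw [e1, e2] at h2
    linarith
  have hlim : Tendsto (fun t : ℝ => (Real.exp (c * t ^ 2 / 2) - 1) / (t ^ 2 / 2)) (𝓝[>] 0)
      (𝓝 (c : ℝ)) := by
    have hd : HasDerivAt (fun x : ℝ => Real.exp (c * x)) c 0 := by
      have := ((hasDerivAt_id (0 : ℝ)).const_mul (c : ℝ)).exp
      simpa using this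
    have hs := hasDerivAt_iff_tendsto_slope_zero.1 hd
    have ht : Tendsto (fun t : ℝ => t ^ 2 / 2) (𝓝[>] 0) (𝓝[≠] 0) := by
      refine tendsto_nhdsWithin_iff.2 ⟨?_, ?_⟩
      · refine Tendsto.mono_left ?_ nhdsWithin_le_nhds
        have : Continuous fun t : ℝ => t ^ 2 / 2 := by fun_prop
        simpa using this.tendsto 0
      · filter_upwards [self_mem_nhdsWithin] with t ht
        have : (0 : ℝ) < t := ht
        simp only [Set.mem_compl_iff, Set.mem_singleton_iff]
        positivity
    refine (hs.comp ht).congr fun t => ?_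
    simp only [Function.comp, zero_add, smul_eq_mul, mul_zero, Real.exp_zero]
    rw [mul_div_assoc, div_eq_inv_mul (_ - 1)]
  refine ge_of_tendsto hlim ?_
  filter_upwards [self_mem_nhdsWithin] with t ht using key t ht

end SubGaussian

/-! ### Maxima on the tree: independence, moments, concentration -/

/-- The maxima of the approximating processes, given by their recursion. -/
noncomputable def treeMax {Ω : Type*} (q : ℝ) (N : List Bool → Ω → ℝ) : ℕ → List Bool → Ω → ℝ
  | 0, _, _ => 0
  | n + 1, ϑ, ω => max (q * treeMax q N n (ϑ ++ [false]) ω + N ϑ ω)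
      (q * treeMax q N n (ϑ ++ [true]) ω - N ϑ ω)

/-- The `σ`-algebra generated by the variables at the nodes in `A`. -/
@[reducible]
def nodeSigma {Ω : Type*} (N : List Bool → Ω → ℝ) (A : Set (List Bool)) : MeasurableSpace Ω :=
  ⨆ w ∈ A, MeasurableSpace.comap (N w) inferInstance

lemma nodeSigma_mono {Ω : Type*} (N : List Bool → Ω → ℝ) {A B : Set (List Bool)} (h : A ⊆ B) :
    nodeSigma N A ≤ nodeSigma N B :=
  biSup_mono fun _ hw => h hw

lemma measurable_nodeSigma {Ω : Type*} (N : List Bool → Ω → ℝ) {A : Set (List Bool)}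
    {w : List Bool} (hw : w ∈ A) : Measurable[nodeSigma N A] (N w) :=
  measurable_iff_comap_le.2 (le_biSup (fun w => MeasurableSpace.comap (N w) inferInstance) hw)

/-- The nodes of the subtree with root `ϑ`. -/
def subtree (ϑ : List Bool) : Set (List Bool) := {w | ϑ <+: w}

lemma subtree_append_subset (ϑ τ : List Bool) : subtree (ϑ ++ τ) ⊆ subtree ϑ :=
  fun _ hw => (List.prefix_append ϑ τ).trans hw

lemma mem_subtree_self (ϑ : List Bool) : ϑ ∈ subtree ϑ := List.prefix_refl ϑ

lemma disjoint_subtree_children (ϑ : List Bool) :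
    Disjoint (subtree (ϑ ++ [false])) (subtree (ϑ ++ [true])) := by
  refine Set.disjoint_left.2 fun w h0 h1 => ?_
  obtain ⟨u, rfl⟩ := h0
  obtain ⟨v, hv⟩ := h1
  simp at hv

lemma notMem_subtree_child (ϑ : List Bool) (b : Bool) : ϑ ∉ subtree (ϑ ++ [b]) := by
  rintro ⟨u, hu⟩
  have := congrArg List.length hu
  simp at this

/-- Independence of the two child maxima and the variable at the parent reduces to disjointness of
their sets of nodes. -/
lemma measurable_treeMax_nodeSigma {Ω : Type*} (q : ℝ) (N : List Bool → Ω → ℝ) (n : ℕ) :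
    ∀ ϑ, Measurable[nodeSigma N (subtree ϑ)] (treeMax q N n ϑ) := by
  induction n with
  | zero => exact fun ϑ => measurable_const
  | succ n ih =>
    intro ϑ
    have h0 := (ih (ϑ ++ [false])).mono (nodeSigma_mono N (subtree_append_subset _ _)) le_rfl
    have h1 := (ih (ϑ ++ [true])).mono (nodeSigma_mono N (subtree_append_subset _ _)) le_rfl
    have h := measurable_nodeSigma N (mem_subtree_self ϑ)
    exact ((h0.const_mul q).add h).max ((h1.const_mul q).sub h)

section Probability

variable {Ω : Type*} [MeasurableSpace Ω] {P : Measure Ω} {N : List Bool → Ω → ℝ}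

lemma nodeSigma_le (hN : ∀ ϑ, Measurable (N ϑ)) (A : Set (List Bool)) :
    nodeSigma N A ≤ ‹MeasurableSpace Ω› :=
  iSup₂_le fun w _ => (hN w).comap_le

lemma indepFun_of_disjoint (hN : ∀ ϑ, Measurable (N ϑ)) (hI : iIndepFun N P)
    {A B : Set (List Bool)} (hAB : Disjoint A B) {E F : Type*} [MeasurableSpace E]
    [MeasurableSpace F] {X : Ω → E} {Y : Ω → F} (hX : Measurable[nodeSigma N A] X)
    (hY : Measurable[nodeSigma N B] Y) : IndepFun X Y P :=
  (IndepFun_iff_Indep X Y P).2 <| indep_of_indep_of_le_left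
    (indep_of_indep_of_le_right (indep_iSup_of_disjoint (fun w => (hN w).comap_le) hI.iIndep hAB)
      (measurable_iff_comap_le.1 hY)) (measurable_iff_comap_le.1 hX)

lemma measurable_treeMax (hN : ∀ ϑ, Measurable (N ϑ)) (q : ℝ) (n : ℕ) (ϑ : List Bool) :
    Measurable (treeMax q N n ϑ) :=
  (measurable_treeMax_nodeSigma q N n ϑ).mono (nodeSigma_le hN _) le_rfl

lemma indepFun_treeMax_node (hN : ∀ ϑ, Measurable (N ϑ)) (hI : iIndepFun N P) (q : ℝ) (n : ℕ)
    (ϑ : List Bool) (b : Bool) : IndepFun (treeMax q N n (ϑ ++ [b])) (N ϑ) P :=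
  indepFun_of_disjoint hN hI (Set.disjoint_singleton_right.2 (notMem_subtree_child ϑ b))
    (measurable_treeMax_nodeSigma q N n _) (measurable_nodeSigma N (Set.mem_singleton ϑ))

lemma memLp_node (hN : ∀ ϑ, Measurable (N ϑ)) (hlaw : ∀ ϑ, P.map (N ϑ) = gaussianReal 0 1)
    (ϑ : List Bool) : MemLp (N ϑ) 2 P := by
  have h := memLp_id_gaussianReal (μ := 0) (v := 1) 2
  rw [← hlaw ϑ, memLp_map_measure_iff (by fun_prop) (hN ϑ).aemeasurable] at h
  exact_mod_cast h

lemma integral_node (hN : ∀ ϑ, Measurable (N ϑ)) (hlaw : ∀ ϑ, P.map (N ϑ) = gaussianReal 0 1)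
    (ϑ : List Bool) : ∫ ω, N ϑ ω ∂P = 0 := by
  have h := integral_map (μ := P) (hN ϑ).aemeasurable (f := fun x : ℝ => x) (by fun_prop)
  rw [hlaw, integral_id_gaussianReal] at h
  exact h.symm

lemma integral_abs_gaussianReal : ∫ x, |x| ∂(gaussianReal 0 1) = Real.sqrt (2 / Real.pi) := by
  rw [integral_gaussianReal_eq_integral_smul one_ne_zero]
  have e : ∀ x : ℝ, gaussianPDFReal 0 1 x • |x|
      = (Real.sqrt (2 * Real.pi))⁻¹ * (fun y => y * Real.exp (-(1 / 2) * y ^ 2)) |x| := by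
    intro x
    simp only [gaussianPDFReal, smul_eq_mul, NNReal.coe_one, mul_one, sub_zero, sq_abs]
    rw [mul_assoc, mul_comm |x|]
    congr 3
    ring
  simp_rw [e]
  rw [integral_const_mul, integral_comp_abs (f := fun y => y * Real.exp (-(1 / 2) * y ^ 2))]
  have h := integral_rpow_mul_exp_neg_mul_rpow (p := 2) (q := 1) (b := 1 / 2) (by norm_num)
    (by norm_num) (by norm_num)
  have h' : ∫ x in Set.Ioi (0 : ℝ), x * Real.exp (-(1 / 2) * x ^ 2) = 1 := by
    have : ∫ x in Set.Ioi (0 : ℝ), x * Real.exp (-(1 / 2) * x ^ 2)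
        = ∫ x in Set.Ioi (0 : ℝ), x ^ (1 : ℝ) * Real.exp (-(1 / 2) * x ^ (2 : ℝ)) := by
      refine integral_congr_ae (Eventually.of_forall fun x => ?_)
      simp
    rw [this, h]
    norm_num
  rw [h', mul_one, Real.sqrt_div zero_le_two, Real.sqrt_mul zero_le_two]
  have h2 : Real.sqrt 2 * Real.sqrt 2 = 2 := Real.mul_self_sqrt zero_le_two
  have : Real.sqrt 2 ≠ 0 := by positivity
  have : Real.sqrt Real.pi ≠ 0 := by positivity
  field_simp
  linarith

lemma integral_abs_node (hN : ∀ ϑ, Measurable (N ϑ)) (hlaw : ∀ ϑ, P.map (N ϑ) = gaussianReal 0 1)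
    (ϑ : List Bool) : ∫ ω, |N ϑ ω| ∂P = Real.sqrt (2 / Real.pi) := by
  have h := integral_map (μ := P) (hN ϑ).aemeasurable (f := fun x : ℝ => |x|) (by fun_prop)
  rw [hlaw, integral_abs_gaussianReal] at h
  exact h.symm

lemma integral_node_sq (hN : ∀ ϑ, Measurable (N ϑ)) (hlaw : ∀ ϑ, P.map (N ϑ) = gaussianReal 0 1)
    (ϑ : List Bool) : ∫ ω, N ϑ ω ^ 2 ∂P = 1 := by
  have h := variance_id_gaussianReal (μ := 0) (v := 1)
  rw [← hlaw ϑ, variance_id_map (hN ϑ).aemeasurable,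
    variance_of_integral_eq_zero (hN ϑ).aemeasurable (integral_node hN hlaw ϑ)] at h
  simpa using h

/-- Second moments of the maxima. -/
lemma memLp_treeMax_and_integral_sq_le (hN : ∀ ϑ, Measurable (N ϑ))
    (hlaw : ∀ ϑ, P.map (N ϑ) = gaussianReal 0 1) (hI : iIndepFun N P) {q : ℝ}
    (hq : 2 * q ^ 2 < 1) (n : ℕ) :
    ∀ ϑ, MemLp (treeMax q N n ϑ) 2 P ∧
      ∫ ω, treeMax q N n ϑ ω ^ 2 ∂P ≤ 2 / (1 - 2 * q ^ 2) := by
  have hpos : 0 < 1 - 2 * q ^ 2 := by linarith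
  induction n with
  | zero =>
    intro ϑ
    refine ⟨MemLp.zero, ?_⟩
    simp only [treeMax]
    simp only [ne_eq, OfNat.ofNat_ne_zero, not_false_eq_true, zero_pow, integral_zero]
    positivity
  | succ n ih =>
    intro ϑ
    have hX := memLp_node hN hlaw ϑ
    -- Both branches at once, with e = 1 and e = -1: the cross term vanishes because the child
    -- maximum is independent of the centred variable at ϑ.
    have key : ∀ b, MemLp (treeMax q N n (ϑ ++ [b])) 2 P ∧ ∀ e : ℝ, e ^ 2 = 1 →
        ∫ ω, (q * treeMax q N n (ϑ ++ [b]) ω + e * N ϑ ω) ^ 2 ∂P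
          ≤ q ^ 2 * (2 / (1 - 2 * q ^ 2)) + 1 := by
      intro b
      obtain ⟨hA, hA2⟩ := ih (ϑ ++ [b])
      refine ⟨hA, fun e he => ?_⟩
      have hAX := (indepFun_treeMax_node hN hI q n ϑ b).integral_fun_mul_eq_mul_integral
        hA.aestronglyMeasurable hX.aestronglyMeasurable
      rw [integral_node hN hlaw, mul_zero] at hAX
      have i1 : Integrable (fun ω => q ^ 2 * treeMax q N n (ϑ ++ [b]) ω ^ 2) P :=
        hA.integrable_sq.const_mul _
      have i2 : Integrable (fun ω => 2 * q * e * (treeMax q N n (ϑ ++ [b]) ω * N ϑ ω)) P :=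
        (hA.integrable_mul hX).const_mul _
      have i3 : Integrable (fun ω => N ϑ ω ^ 2) P := hX.integrable_sq
      have e1 : ∫ ω, (q * treeMax q N n (ϑ ++ [b]) ω + e * N ϑ ω) ^ 2 ∂P
          = ∫ ω, (q ^ 2 * treeMax q N n (ϑ ++ [b]) ω ^ 2
            + 2 * q * e * (treeMax q N n (ϑ ++ [b]) ω * N ϑ ω) + N ϑ ω ^ 2) ∂P := by
        congr 1 with ω
        linear_combination N ϑ ω ^ 2 * he
      have i12 : Integrable (fun ω => q ^ 2 * treeMax q N n (ϑ ++ [b]) ω ^ 2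
            + 2 * q * e * (treeMax q N n (ϑ ++ [b]) ω * N ϑ ω)) P := i1.add i2
      rw [e1, integral_add i12 i3, integral_add i1 i2, integral_const_mul, integral_const_mul,
        hAX, integral_node_sq hN hlaw]
      have := mul_le_mul_of_nonneg_left hA2 (sq_nonneg q)
      linarith
    obtain ⟨hA, hA2⟩ := key false
    obtain ⟨hB, hB2⟩ := key true
    have h1 : MemLp (fun ω => q * treeMax q N n (ϑ ++ [false]) ω + 1 * N ϑ ω) 2 P :=
      (hA.const_mul q).add (hX.const_mul 1)
    have h2 : MemLp (fun ω => q * treeMax q N n (ϑ ++ [true]) ω + (-1) * N ϑ ω) 2 P :=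
      (hB.const_mul q).add (hX.const_mul (-1))
    have hmax : treeMax q N (n + 1) ϑ = (fun ω => q * treeMax q N n (ϑ ++ [false]) ω + 1 * N ϑ ω)
        ⊔ (fun ω => q * treeMax q N n (ϑ ++ [true]) ω + (-1) * N ϑ ω) := by
      ext ω
      simp [treeMax, sub_eq_add_neg]
    have hm : MemLp (treeMax q N (n + 1) ϑ) 2 P := by
      rw [hmax]
      exact h1.sup h2
    refine ⟨hm, ?_⟩
    have hle : ∫ ω, treeMax q N (n + 1) ϑ ω ^ 2 ∂P
        ≤ ∫ ω, ((q * treeMax q N n (ϑ ++ [false]) ω + 1 * N ϑ ω) ^ 2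
          + (q * treeMax q N n (ϑ ++ [true]) ω + (-1) * N ϑ ω) ^ 2) ∂P := by
      refine integral_mono hm.integrable_sq (h1.integrable_sq.add h2.integrable_sq) fun ω => ?_
      simp only [hmax, Pi.sup_apply]
      rcases max_cases (q * treeMax q N n (ϑ ++ [false]) ω + 1 * N ϑ ω)
        (q * treeMax q N n (ϑ ++ [true]) ω + (-1) * N ϑ ω) with ⟨h, _⟩ | ⟨h, _⟩ <;> rw [h]
      · exact le_add_of_nonneg_right (sq_nonneg _)
      · exact le_add_of_nonneg_left (sq_nonneg _)
    rw [integral_add h1.integrable_sq h2.integrable_sq] at hle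
    -- The bound is the fixed point of x ↦ 2(q²x + 1).
    have e3 : 2 / (1 - 2 * q ^ 2) = 2 * (q ^ 2 * (2 / (1 - 2 * q ^ 2)) + 1) := by
      field_simp
      ring
    have := hA2 1 (by norm_num)
    have := hB2 (-1) (by norm_num)
    rw [e3]
    linarith

variable [IsProbabilityMeasure P]

lemma map_treeMax_children (hN : ∀ ϑ, Measurable (N ϑ))
    (hlaw : ∀ ϑ, P.map (N ϑ) = gaussianReal 0 1) (hI : iIndepFun N P) (q : ℝ) (n : ℕ)
    (ϑ : List Bool) :
    P.map (fun ω => (treeMax q N n (ϑ ++ [false]) ω, treeMax q N n (ϑ ++ [true]) ω, N ϑ ω))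
      = (P.map (treeMax q N n (ϑ ++ [false]))).prod
        ((P.map (treeMax q N n (ϑ ++ [true]))).prod (gaussianReal 0 1)) := by
  have m0 := measurable_treeMax hN q n (ϑ ++ [false])
  have m1 := measurable_treeMax hN q n (ϑ ++ [true])
  have i1 := indepFun_treeMax_node hN hI q n ϑ true
  have i2 : IndepFun (treeMax q N n (ϑ ++ [false]))
      (fun ω => (treeMax q N n (ϑ ++ [true]) ω, N ϑ ω)) P := by
    refine indepFun_of_disjoint hN hI (A := subtree (ϑ ++ [false]))
      (B := subtree (ϑ ++ [true]) ∪ {ϑ}) ?_ (measurable_treeMax_nodeSigma q N n _) ?_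
    · exact Set.disjoint_union_right.2 ⟨disjoint_subtree_children ϑ,
        Set.disjoint_singleton_right.2 (notMem_subtree_child ϑ false)⟩
    · exact ((measurable_treeMax_nodeSigma q N n _).mono
        (nodeSigma_mono N Set.subset_union_left) le_rfl).prodMk
        (measurable_nodeSigma N (Or.inr rfl))
  rw [(indepFun_iff_map_prod_eq_prod_map_map m0.aemeasurable
    (m1.prodMk (hN ϑ)).aemeasurable).1 i2,
    (indepFun_iff_map_prod_eq_prod_map_map m1.aemeasurable (hN ϑ).aemeasurable).1 i1, hlaw]

/-- The recursion replaces c by q²c + 1, so at the fixed point the constant is the same for all n;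
the induction starts from a point mass. -/
lemma infConvBound_treeMax (hN : ∀ ϑ, Measurable (N ϑ))
    (hlaw : ∀ ϑ, P.map (N ϑ) = gaussianReal 0 1) (hI : iIndepFun N P) {q c : ℝ} (hq : 0 < q)
    (hc : 0 < c) (hqc : q ^ 2 * c + 1 = c) (n : ℕ) :
    ∀ ϑ, InfConvBound (P.map (treeMax q N n ϑ)) (fun x y => (x - y) ^ 2 / (2 * c)) := by
  induction n with
  | zero =>
    intro ϑ
    have h0 : P.map (treeMax q N 0 ϑ) = Measure.dirac 0 := by
      change P.map (fun _ => (0 : ℝ)) = _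
      simp
    rw [h0]
    refine ⟨fun K h hK => integrable_dirac (by simp), fun K g h hg hK hgh => ?_⟩
    rw [lintegral_dirac' _ hg, integral_dirac]
    simpa using hgh 0 0
  | succ n ih =>
    intro ϑ
    have m0 := measurable_treeMax hN q n (ϑ ++ [false])
    have m1 := measurable_treeMax hN q n (ϑ ++ [true])
    have := Measure.isProbabilityMeasure_map (μ := P) m0.aemeasurable
    have := Measure.isProbabilityMeasure_map (μ := P) m1.aemeasurable
    have h := InfConvBound.map_max hq hc (ih (ϑ ++ [false])) (ih (ϑ ++ [true]))
    rw [hqc, ← map_treeMax_children hN hlaw hI, Measure.map_map (by fun_prop)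
      (m0.prodMk (m1.prodMk (hN ϑ)))] at h
    exact h

lemma lintegral_exp_treeMax_le (hN : ∀ ϑ, Measurable (N ϑ))
    (hlaw : ∀ ϑ, P.map (N ϑ) = gaussianReal 0 1) (hI : iIndepFun N P) {q c : ℝ} (hq : 0 < q)
    (hc : 0 < c) (hqc : q ^ 2 * c + 1 = c) (n : ℕ) (ϑ : List Bool) (t : ℝ) :
    ∫⁻ ω, ENNReal.ofReal (Real.exp (t * (treeMax q N n ϑ ω - ∫ ω', treeMax q N n ϑ ω' ∂P))) ∂P
      ≤ ENNReal.ofReal (Real.exp (c * t ^ 2 / 2)) := by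
  have m := measurable_treeMax hN q n ϑ
  have h := (infConvBound_treeMax hN hlaw hI hq hc hqc n ϑ).lintegral_exp_le hc t
  rw [lintegral_map (by fun_prop) m, integral_map m.aemeasurable (by fun_prop)] at h
  exact h

/-- Lower bound for the means of the maxima. -/
lemma le_integral_treeMax (hN : ∀ ϑ, Measurable (N ϑ))
    (hlaw : ∀ ϑ, P.map (N ϑ) = gaussianReal 0 1) (hI : iIndepFun N P) {q : ℝ} (hq0 : 0 < q)
    (hq : 2 * q ^ 2 < 1) (n : ℕ) :
    ∀ ϑ, Real.sqrt (2 / Real.pi) * ∑ k ∈ Finset.range n, q ^ k ≤ ∫ ω, treeMax q N n ϑ ω ∂P := by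
  induction n with
  | zero => intro ϑ; simp [treeMax]
  | succ n ih =>
    intro ϑ
    set m := Real.sqrt (2 / Real.pi) * ∑ k ∈ Finset.range n, q ^ k with hm
    have hX := memLp_node hN hlaw ϑ
    have hXi : Integrable (N ϑ) P := hX.integrable (by norm_num)
    -- Left branch if the variable at ϑ is nonnegative, right branch otherwise. This choice
    -- contributes |N ϑ| and is independent of each child maximum.
    set D0 : Set ℝ := Set.Ici 0
    set D1 : Set ℝ := Set.Iio 0
    have hD0 : MeasurableSet D0 := measurableSet_Ici
    have hD1 : MeasurableSet D1 := measurableSet_Iio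
    have key : ∀ b (D : Set ℝ), MeasurableSet D →
        Integrable (fun ω => treeMax q N n (ϑ ++ [b]) ω * D.indicator 1 (N ϑ ω)) P ∧
        m * ∫ ω, D.indicator (1 : ℝ → ℝ) (N ϑ ω) ∂P
          ≤ ∫ ω, treeMax q N n (ϑ ++ [b]) ω * D.indicator 1 (N ϑ ω) ∂P := by
      intro b D hD
      have hA := (memLp_treeMax_and_integral_sq_le hN hlaw hI hq n (ϑ ++ [b])).1
      have hind : Measurable (D.indicator (1 : ℝ → ℝ)) := measurable_one.indicator hD
      have hbd : ∀ ω, ‖D.indicator (1 : ℝ → ℝ) (N ϑ ω)‖ ≤ 1 := fun ω => by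
        by_cases h : N ϑ ω ∈ D <;> simp [h]
      refine ⟨(hA.integrable (by norm_num)).mul_bdd (c := 1)
        (hind.comp (hN ϑ)).aestronglyMeasurable (Eventually.of_forall hbd), ?_⟩
      have hi := (indepFun_treeMax_node hN hI q n ϑ b).comp measurable_id hind
      have := hi.integral_fun_mul_eq_mul_integral hA.aestronglyMeasurable
        (hind.comp (hN ϑ)).aestronglyMeasurable
      simp only [Function.comp, id] at this
      rw [this]
      refine mul_le_mul_of_nonneg_right (ih _) (integral_nonneg fun ω => ?_)
      exact Set.indicator_nonneg (fun _ _ => zero_le_one) _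
    obtain ⟨i0, h0⟩ := key false D0 hD0
    obtain ⟨i1, h1⟩ := key true D1 hD1
    have hsum : (∫ ω, D0.indicator (1 : ℝ → ℝ) (N ϑ ω) ∂P)
        + ∫ ω, D1.indicator (1 : ℝ → ℝ) (N ϑ ω) ∂P = 1 := by
      have hi : ∀ D : Set ℝ, MeasurableSet D →
          Integrable (fun ω => D.indicator (1 : ℝ → ℝ) (N ϑ ω)) P := fun D hD =>
        Integrable.mono' (integrable_const 1)
          ((measurable_one.indicator hD).comp (hN ϑ)).aestronglyMeasurable
          (Eventually.of_forall fun ω => by by_cases h : N ϑ ω ∈ D <;> simp [h])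
      rw [← integral_add (hi D0 hD0) (hi D1 hD1)]
      have : ∀ ω, D0.indicator (1 : ℝ → ℝ) (N ϑ ω) + D1.indicator (1 : ℝ → ℝ) (N ϑ ω) = 1 := by
        intro ω
        rcases le_or_gt 0 (N ϑ ω) with h | h
        · simp [D0, D1, h]
        · simp [D0, D1, h]
      simp [this]
    have hle : ∀ ω, q * (treeMax q N n (ϑ ++ [false]) ω * D0.indicator 1 (N ϑ ω))
        + q * (treeMax q N n (ϑ ++ [true]) ω * D1.indicator 1 (N ϑ ω)) + |N ϑ ω|
        ≤ treeMax q N (n + 1) ϑ ω := by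
      intro ω
      simp only [treeMax]
      rcases le_or_gt 0 (N ϑ ω) with h | h
      · have e : |N ϑ ω| = N ϑ ω := abs_of_nonneg h
        refine le_trans (le_of_eq ?_) (le_max_left _ _)
        simp [D0, D1, h, e]
      · have e : |N ϑ ω| = - N ϑ ω := abs_of_neg h
        refine le_trans (le_of_eq ?_) (le_max_right _ _)
        simp [D0, D1, h, e, sub_eq_add_neg]
    have hint := integral_mono
      (((i0.const_mul q).add (i1.const_mul q)).add hXi.abs)
      ((memLp_treeMax_and_integral_sq_le hN hlaw hI hq (n + 1) ϑ).1.integrable (by norm_num)) hle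
    have e1 : ∫ ω, (q * (treeMax q N n (ϑ ++ [false]) ω * D0.indicator 1 (N ϑ ω))
        + q * (treeMax q N n (ϑ ++ [true]) ω * D1.indicator 1 (N ϑ ω)) + |N ϑ ω|) ∂P
        = q * (∫ ω, treeMax q N n (ϑ ++ [false]) ω * D0.indicator 1 (N ϑ ω) ∂P)
          + q * (∫ ω, treeMax q N n (ϑ ++ [true]) ω * D1.indicator 1 (N ϑ ω) ∂P)
          + Real.sqrt (2 / Real.pi) := by
      have i01 : Integrable (fun ω => q * (treeMax q N n (ϑ ++ [false]) ω * D0.indicator 1 (N ϑ ω))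
        + q * (treeMax q N n (ϑ ++ [true]) ω * D1.indicator 1 (N ϑ ω))) P :=
        (i0.const_mul q).add (i1.const_mul q)
      rw [integral_add i01 hXi.abs, integral_add (i0.const_mul q) (i1.const_mul q),
        integral_const_mul, integral_const_mul, integral_abs_node hN hlaw]
    have hint' : _ ≤ ∫ ω, treeMax q N (n + 1) ϑ ω ∂P := e1 ▸ hint
    have e2 : Real.sqrt (2 / Real.pi) * ∑ k ∈ Finset.range (n + 1), q ^ k
        = q * m + Real.sqrt (2 / Real.pi) := by
      rw [hm, Finset.sum_range_succ', mul_add, pow_zero, mul_one, Finset.mul_sum, Finset.mul_sum,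
        Finset.mul_sum]
      congr 1
      refine Finset.sum_congr rfl fun k _ => ?_
      ring
    rw [e2]
    have e3 : q * m = q * (m * ∫ ω, D0.indicator (1 : ℝ → ℝ) (N ϑ ω) ∂P)
        + q * (m * ∫ ω, D1.indicator (1 : ℝ → ℝ) (N ϑ ω) ∂P) := by
      rw [← mul_add, ← mul_add, hsum, mul_one]
    rw [e3]
    refine le_trans ?_ hint'
    gcongr

end Probability

/-! ### Pathwise convergence and identification of the suprema -/

section Pathwise

variable {Ω : Type*} {α q : ℝ} {N : List Bool → Ω → ℝ}

lemma approxProcess_succ (hq : q = (1 / 2 : ℝ) ^ (1 - α / 2)) (n : ℕ) (ϑ : List Bool) (ω : Ω)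
    (t : ℝ) : approxProcess α N (n + 1) ϑ ω t =
      if t < 1 / 2 then q * approxProcess α N n (ϑ ++ [false]) ω (2 * t) + N ϑ ω
      else q * approxProcess α N n (ϑ ++ [true]) ω (2 * t - 1) - N ϑ ω := by
  have e1 : t / (1 / 2) = 2 * t := by ring
  have e2 : (t - 1 / 2) / (1 - 1 / 2) = 2 * t - 1 := by ring
  rw [approxProcess, ← hq, opA, opB, sg, e1, e2]
  split_ifs with h1 h2
  · exact absurd h1 (not_lt.2 h2)
  · ring
  · ring
  · exact absurd (not_lt.1 h1) ‹_›

/-- Passing from n to n + 1 adds, at each t, the single variable at the node of relative depth n on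
the path of t, with weight ±q^n. -/
lemma exists_abs_approxProcess_succ_sub_eq (hq : q = (1 / 2 : ℝ) ^ (1 - α / 2)) (hq0 : 0 ≤ q)
    (ω : Ω) (n : ℕ) : ∀ ϑ t, ∃ w : List Bool, w.length = n ∧
      abs (approxProcess α N (n + 1) ϑ ω t - approxProcess α N n ϑ ω t)
        = q ^ n * |N (ϑ ++ w) ω| := by
  induction n with
  | zero =>
    intro ϑ t
    refine ⟨[], rfl, ?_⟩
    rw [approxProcess_succ hq]
    split_ifs <;> simp [approxProcess]
  | succ n ih =>
    intro ϑ t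
    have key : ∀ b t', ∃ w : List Bool, w.length = n + 1 ∧
        |q * approxProcess α N (n + 1) (ϑ ++ [b]) ω t' - q * approxProcess α N n (ϑ ++ [b]) ω t'|
          = q ^ (n + 1) * |N (ϑ ++ w) ω| := by
      intro b t'
      obtain ⟨w, hw, h⟩ := ih (ϑ ++ [b]) t'
      refine ⟨b :: w, by simp [hw], ?_⟩
      rw [← mul_sub, abs_mul, h, abs_of_nonneg hq0]
      simp [pow_succ']
      ring
    rw [approxProcess_succ hq (n + 1) ϑ, approxProcess_succ hq n ϑ]
    split_ifs
    · simpa using key false (2 * t)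
    · simpa using key true (2 * t - 1)

lemma approxProcess_le_treeMax (hq : q = (1 / 2 : ℝ) ^ (1 - α / 2)) (hq0 : 0 ≤ q)
    (ω : Ω) (n : ℕ) : ∀ ϑ, ∀ t ∈ Set.Icc (0 : ℝ) 1,
      approxProcess α N n ϑ ω t ≤ treeMax q N n ϑ ω := by
  induction n with
  | zero => intro ϑ t _; simp [approxProcess, treeMax]
  | succ n ih =>
    intro ϑ t ht
    rw [approxProcess_succ hq, treeMax]
    split_ifs with h
    · refine le_trans ?_ (le_max_left _ _)
      gcongr
      exact ih _ _ ⟨by linarith [ht.1], by linarith⟩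
    · refine le_trans ?_ (le_max_right _ _)
      gcongr
      exact ih _ _ ⟨by linarith, by linarith [ht.2]⟩

/-- The half-open interval matters: t < 1 ensures t/2 < 1/2, so the rescaled point stays in the left
branch. -/
lemma exists_approxProcess_eq_treeMax (hq : q = (1 / 2 : ℝ) ^ (1 - α / 2))
    (ω : Ω) (n : ℕ) : ∀ ϑ, ∃ t ∈ Set.Ico (0 : ℝ) 1,
      approxProcess α N n ϑ ω t = treeMax q N n ϑ ω := by
  induction n with
  | zero => exact fun ϑ => ⟨0, by simp, rfl⟩
  | succ n ih =>
    intro ϑ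
    rw [treeMax]
    obtain ⟨t0, ht0, h0⟩ := ih (ϑ ++ [false])
    obtain ⟨t1, ht1, h1⟩ := ih (ϑ ++ [true])
    rcases max_choice (q * treeMax q N n (ϑ ++ [false]) ω + N ϑ ω)
      (q * treeMax q N n (ϑ ++ [true]) ω - N ϑ ω) with h | h <;> rw [h]
    · refine ⟨t0 / 2, ⟨by linarith [ht0.1], by linarith [ht0.2]⟩, ?_⟩
      rw [approxProcess_succ hq, if_pos (by linarith [ht0.2]), mul_div_cancel₀ _ two_ne_zero, h0]
    · refine ⟨(t1 + 1) / 2, ⟨by linarith [ht1.1], by linarith [ht1.2]⟩, ?_⟩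
      rw [approxProcess_succ hq, if_neg (by linarith [ht1.1]), mul_div_cancel₀ _ two_ne_zero,
        add_sub_cancel_right, h1]

lemma Sn_eq_treeMax (hq : q = (1 / 2 : ℝ) ^ (1 - α / 2)) (hq0 : 0 ≤ q) (n : ℕ) :
    Sn α N n = treeMax q N n [] := by
  ext ω
  obtain ⟨t, ht, h⟩ := exists_approxProcess_eq_treeMax (N := N) hq ω n []
  have hle : ∀ t : Set.Icc (0 : ℝ) 1, Zn α N n ω t ≤ treeMax q N n [] ω := fun t =>
    approxProcess_le_treeMax hq hq0 ω n [] t t.2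
  refine le_antisymm (ciSup_le hle) ?_
  rw [← h]
  exact le_ciSup (f := fun t : Set.Icc (0 : ℝ) 1 => Zn α N n ω t)
    ⟨_, Set.forall_mem_range.2 hle⟩ ⟨t, ht.1, ht.2.le⟩

lemma abs_Zn_sub_Z_le (hq : q = (1 / 2 : ℝ) ^ (1 - α / 2)) (hq0 : 0 ≤ q) {ω : Ω} {B s : ℝ}
    (hs : s < 1) (hB : ∀ w : List Bool, q ^ w.length * |N w ω| ≤ B * s ^ w.length) (n : ℕ)
    (t : ℝ) : |Zn α N n ω t - Z α N ω t| ≤ B * s ^ n / (1 - s) := by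
  have hstep : ∀ n, dist (Zn α N n ω t) (Zn α N (n + 1) ω t) ≤ B * s ^ n := by
    intro n
    obtain ⟨w, hw, h⟩ := exists_abs_approxProcess_succ_sub_eq (N := N) hq hq0 ω n [] t
    rw [Real.dist_eq, abs_sub_comm, Zn, Zn, h, ← hw]
    exact hB w
  have hlim : Tendsto (fun n => Zn α N n ω t) atTop (𝓝 (Z α N ω t)) :=
    (cauchySeq_of_le_geometric s B hs hstep).tendsto_limUnder
  exact dist_le_of_le_geometric_of_tendsto s B hs hstep hlim n

lemma abs_Z_le (hq : q = (1 / 2 : ℝ) ^ (1 - α / 2)) (hq0 : 0 ≤ q) {ω : Ω} {B s : ℝ}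
    (hs : s < 1) (hB : ∀ w : List Bool, q ^ w.length * |N w ω| ≤ B * s ^ w.length)
    (t : ℝ) : |Z α N ω t| ≤ B / (1 - s) := by
  simpa [Zn, approxProcess] using abs_Zn_sub_Z_le hq hq0 hs hB 0 t

lemma Z_le_S (hq : q = (1 / 2 : ℝ) ^ (1 - α / 2)) (hq0 : 0 ≤ q) {ω : Ω} {B s : ℝ}
    (hs : s < 1) (hB : ∀ w : List Bool, q ^ w.length * |N w ω| ≤ B * s ^ w.length)
    {t : ℝ} (ht : t ∈ Set.Icc (0 : ℝ) 1) : Z α N ω t ≤ S α N ω :=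
  le_ciSup (f := fun t : Set.Icc (0 : ℝ) 1 => Z α N ω t)
    ⟨B / (1 - s), Set.forall_mem_range.2 fun t => (le_abs_self _).trans (abs_Z_le hq hq0 hs hB t)⟩
    ⟨t, ht⟩

lemma abs_Sn_sub_S_le (hq : q = (1 / 2 : ℝ) ^ (1 - α / 2)) (hq0 : 0 ≤ q) {ω : Ω} {B s : ℝ}
    (hs : s < 1) (hB : ∀ w : List Bool, q ^ w.length * |N w ω| ≤ B * s ^ w.length) (n : ℕ) :
    |Sn α N n ω - S α N ω| ≤ B * s ^ n / (1 - s) := by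
  have hZ := abs_Zn_sub_Z_le hq hq0 hs hB n
  rw [Sn_eq_treeMax hq hq0]
  obtain ⟨t, ht, h⟩ := exists_approxProcess_eq_treeMax (N := N) hq ω n []
  rw [abs_le]
  constructor
  · have : S α N ω ≤ treeMax q N n [] ω + B * s ^ n / (1 - s) := by
      refine ciSup_le fun t => ?_
      have h1 := approxProcess_le_treeMax (N := N) hq hq0 ω n [] t t.2
      have h2 := (abs_le.1 (hZ t)).1
      rw [Zn] at h2
      linarith
    linarith
  · have h1 := Z_le_S hq hq0 hs hB ⟨ht.1, ht.2.le⟩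
    have h2 := (abs_le.1 (hZ t)).2
    rw [Zn, h] at h2
    linarith

lemma tendsto_geometric_div {s : ℝ} (hs0 : 0 ≤ s) (hs : s < 1) (B : ℝ) :
    Tendsto (fun n : ℕ => B * s ^ n / (1 - s)) atTop (𝓝 0) := by
  simpa using ((tendsto_pow_atTop_nhds_zero_of_lt_one hs0 hs).const_mul B).div_const (1 - s)

lemma tendstoUniformlyOn_Zn (hq : q = (1 / 2 : ℝ) ^ (1 - α / 2)) (hq0 : 0 ≤ q) {ω : Ω} {B s : ℝ}
    (hs0 : 0 ≤ s) (hs : s < 1) (hB : ∀ w : List Bool, q ^ w.length * |N w ω| ≤ B * s ^ w.length)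
    (D : Set ℝ) : TendstoUniformlyOn (fun n t => Zn α N n ω t) (Z α N ω) atTop D := by
  rw [Metric.tendstoUniformlyOn_iff]
  intro ε hε
  filter_upwards [(tendsto_geometric_div hs0 hs B).eventually_lt_const hε] with n hn t _
  rw [dist_comm, Real.dist_eq]
  exact (abs_Zn_sub_Z_le hq hq0 hs hB n t).trans_lt hn

end Pathwise

/-! ### A random geometric bound for all nodes -/

lemma tsum_pow_length_ne_top {ρ : ℝ≥0∞} (hρ : 2 * ρ < 1) :
    ∑' w : List Bool, ρ ^ w.length ≠ ∞ := by
  have h : ∑' w : List Bool, ρ ^ w.length = ∑' n : ℕ, (2 * ρ) ^ n := by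
    rw [← (Equiv.sigmaFiberEquiv (List.length : List Bool → ℕ)).tsum_eq, ENNReal.tsum_sigma']
    refine tsum_congr fun n => ?_
    have e : ∀ w : {w : List Bool // w.length = n},
        ρ ^ ((Equiv.sigmaFiberEquiv (List.length : List Bool → ℕ)) ⟨n, w⟩).length = ρ ^ n :=
      fun w => by
        have := w.2
        simp [this]
    simp_rw [e]
    have : Fintype {w : List Bool // w.length = n} :=
      inferInstanceAs (Fintype (List.Vector Bool n))
    have hc : Fintype.card {w : List Bool // w.length = n} = 2 ^ n := by
      rw [← Fintype.card_bool, ← card_vector (α := Bool) n]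
      exact Fintype.card_congr (Equiv.refl _)
    rw [tsum_fintype, Finset.sum_const, Finset.card_univ, hc, nsmul_eq_mul, mul_pow]
    push_cast
    rfl
  rw [h, ENNReal.tsum_geometric]
  exact ENNReal.inv_ne_top.2 (tsub_pos_of_lt hρ).ne'

section Probability

variable {Ω : Type*} [MeasurableSpace Ω] {P : Measure Ω} {N : List Bool → Ω → ℝ}

/-- A square integrable geometric bound for all node contributions. -/
lemma exists_memLp_geometric_bound (hN : ∀ ϑ, Measurable (N ϑ))
    (hlaw : ∀ ϑ, P.map (N ϑ) = gaussianReal 0 1) {q : ℝ} (hq0 : 0 < q) (hq : 2 * q ^ 2 < 1) :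
    ∃ (s : ℝ) (B : Ω → ℝ), 0 ≤ s ∧ s < 1 ∧ MemLp B 2 P ∧
      ∀ᵐ ω ∂P, ∀ w : List Bool, q ^ w.length * |N w ω| ≤ B ω * s ^ w.length := by
  -- With 2q² < r < 1 and ρ = q²/r one has 2ρ < 1, so W = Σ ρ^|w| N_w² has mean Σ (2ρ)^n < ∞. Each
  -- term is at most W, hence (q^|w| N_w)² ≤ W r^|w|; the bound holds with B = √W and s = √r.
  obtain ⟨r, hr1, hr2⟩ := exists_between hq
  have hr0 : 0 < r := lt_trans (by positivity) hr1
  set ρ := q ^ 2 / r with hρ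
  have hρ0 : 0 ≤ ρ := by positivity
  have hρ2 : 2 * ENNReal.ofReal ρ < 1 := by
    rw [← ENNReal.ofReal_ofNat, ← ENNReal.ofReal_mul zero_le_two, ← ENNReal.ofReal_one]
    refine (ENNReal.ofReal_lt_ofReal_iff one_pos).2 ?_
    rw [hρ, ← mul_div_assoc, div_lt_one hr0]
    exact hr1
  set W : Ω → ℝ≥0∞ := fun ω => ∑' w : List Bool, ENNReal.ofReal (ρ ^ w.length * N w ω ^ 2)
  have hWm : Measurable W := Measurable.tsum fun w => by
    have := hN w
    fun_prop
  have hW : ∫⁻ ω, W ω ∂P ≠ ∞ := by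
    rw [lintegral_tsum fun w => by have := hN w; fun_prop]
    have e : ∀ w : List Bool, ∫⁻ ω, ENNReal.ofReal (ρ ^ w.length * N w ω ^ 2) ∂P
        = ENNReal.ofReal ρ ^ w.length := by
      intro w
      rw [← ofReal_integral_eq_lintegral_ofReal ((memLp_node hN hlaw w).integrable_sq.const_mul _)
        (Eventually.of_forall fun ω => by positivity), integral_const_mul,
        integral_node_sq hN hlaw, mul_one, ENNReal.ofReal_pow hρ0]
    simp_rw [e]
    exact tsum_pow_length_ne_top hρ2
  refine ⟨Real.sqrt r, fun ω => Real.sqrt (W ω).toReal, Real.sqrt_nonneg _, ?_, ?_, ?_⟩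
  · rw [Real.sqrt_lt' one_pos]
    linarith
  · rw [memLp_two_iff_integrable_sq hWm.ennreal_toReal.sqrt.aestronglyMeasurable]
    simp_rw [Real.sq_sqrt ENNReal.toReal_nonneg]
    exact integrable_toReal_of_lintegral_ne_top hWm.aemeasurable hW
  · filter_upwards [ae_lt_top hWm hW] with ω hω w
    have h1 : ρ ^ w.length * N w ω ^ 2 ≤ (W ω).toReal :=
      (ENNReal.ofReal_le_iff_le_toReal hω.ne).1
        (ENNReal.le_tsum (f := fun w : List Bool => ENNReal.ofReal (ρ ^ w.length * N w ω ^ 2)) w)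
    refine abs_le_of_sq_le_sq' ?_ (by positivity) |>.2
    rw [mul_pow, mul_pow, sq_abs, Real.sq_sqrt ENNReal.toReal_nonneg, ← pow_mul, ← pow_mul,
      mul_comm w.length, pow_mul, pow_mul, Real.sq_sqrt hr0.le]
    have h2 := mul_le_mul_of_nonneg_right h1 (pow_pos hr0 w.length).le
    refine le_trans (le_of_eq ?_) h2
    rw [hρ, div_pow]
    field_simp

end Probability

lemma measurable_approxProcess_zero {Ω : Type*} {N : List Bool → Ω → ℝ} {α q : ℝ}
    (hq : q = (1 / 2 : ℝ) ^ (1 - α / 2)) (n : ℕ) :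
    ∀ ϑ, Measurable[nodeSigma N (subtree ϑ)] (fun ω => approxProcess α N n ϑ ω 0) := by
  induction n with
  | zero => exact fun ϑ => measurable_const
  | succ n ih =>
    intro ϑ
    have e : (fun ω => approxProcess α N (n + 1) ϑ ω 0)
        = fun ω => q * approxProcess α N n (ϑ ++ [false]) ω 0 + N ϑ ω := by
      ext ω
      rw [approxProcess_succ hq, if_pos (by norm_num), mul_zero]
    rw [e]
    have h0 := (ih (ϑ ++ [false])).mono (nodeSigma_mono N (subtree_append_subset _ _)) le_rfl
    exact (h0.const_mul q).add (measurable_nodeSigma N (mem_subtree_self ϑ))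

/-! ### Passage to the limit and the law of Z(0) -/

section Limit

variable {Ω : Type*} [MeasurableSpace Ω] {P : Measure Ω}
  {N : List Bool → Ω → ℝ} {α q : ℝ}

lemma ae_tendsto_Sn (hN : ∀ ϑ, Measurable (N ϑ)) (hlaw : ∀ ϑ, P.map (N ϑ) = gaussianReal 0 1)
    (hq : q = (1 / 2 : ℝ) ^ (1 - α / 2)) (hq0 : 0 < q) (hq2 : 2 * q ^ 2 < 1) :
    ∀ᵐ ω ∂P, Tendsto (fun n => Sn α N n ω) atTop (𝓝 (S α N ω)) := by
  obtain ⟨s, B, hs0, hs, _, hB⟩ := exists_memLp_geometric_bound hN hlaw hq0 hq2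
  filter_upwards [hB] with ω hω
  rw [tendsto_iff_dist_tendsto_zero]
  exact squeeze_zero (fun _ => dist_nonneg) (fun n => abs_Sn_sub_S_le hq hq0.le hs hω n)
    (tendsto_geometric_div hs0 hs _)

lemma measurable_Sn (hN : ∀ ϑ, Measurable (N ϑ)) (hq : q = (1 / 2 : ℝ) ^ (1 - α / 2))
    (hq0 : 0 < q) (n : ℕ) : Measurable (Sn α N n) := by
  rw [Sn_eq_treeMax hq hq0.le]
  exact measurable_treeMax hN q n []

lemma aemeasurable_S (hN : ∀ ϑ, Measurable (N ϑ)) (hlaw : ∀ ϑ, P.map (N ϑ) = gaussianReal 0 1)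
    (hq : q = (1 / 2 : ℝ) ^ (1 - α / 2)) (hq0 : 0 < q) (hq2 : 2 * q ^ 2 < 1) :
    AEMeasurable (S α N) P :=
  aemeasurable_of_tendsto_metrizable_ae atTop
    (fun n => (measurable_Sn hN hq hq0 n).aemeasurable) (ae_tendsto_Sn hN hlaw hq hq0 hq2)

variable [IsProbabilityMeasure P]

lemma memLp_S_and_tendsto_integral (hN : ∀ ϑ, Measurable (N ϑ))
    (hlaw : ∀ ϑ, P.map (N ϑ) = gaussianReal 0 1)
    (hq : q = (1 / 2 : ℝ) ^ (1 - α / 2)) (hq0 : 0 < q) (hq2 : 2 * q ^ 2 < 1) :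
    MemLp (S α N) 2 P ∧
      Tendsto (fun n => ∫ ω, Sn α N n ω ∂P) atTop (𝓝 (∫ ω, S α N ω ∂P)) := by
  obtain ⟨s, B, hs0, hs, hBm, hB⟩ := exists_memLp_geometric_bound hN hlaw hq0 hq2
  have hB' : MemLp (fun ω => B ω / (1 - s)) 2 P := by
    simp_rw [div_eq_mul_inv]
    exact hBm.mul_const _
  have hS : ∀ᵐ ω ∂P, |S α N ω| ≤ B ω / (1 - s) := by
    filter_upwards [hB] with ω hω
    -- Since S_0 = 0, the case n = 0 bounds S itself.
    have h := abs_Sn_sub_S_le hq hq0.le hs hω 0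
    rw [Sn_eq_treeMax hq hq0.le] at h
    simpa [treeMax] using h
  have hmem : MemLp (S α N) 2 P :=
    hB'.of_le (aemeasurable_S hN hlaw hq hq0 hq2).aestronglyMeasurable (hS.mono fun ω hω =>
      hω.trans (le_abs_self _))
  refine ⟨hmem, tendsto_integral_of_dominated_convergence
    (fun ω => B ω / (1 - s) + B ω / (1 - s))
    (fun n => (measurable_Sn hN hq hq0 n).aestronglyMeasurable)
    ((hB'.integrable (by norm_num)).add (hB'.integrable (by norm_num))) (fun n => ?_)
    (ae_tendsto_Sn hN hlaw hq hq0 hq2)⟩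
  filter_upwards [hB, hS] with ω hω hSω
  have h := abs_Sn_sub_S_le hq hq0.le hs hω n
  have hB0 : 0 ≤ B ω := by
    have := hω []
    simp only [List.length_nil, pow_zero, one_mul, mul_one] at this
    exact (abs_nonneg _).trans this
  have h1 : B ω * s ^ n / (1 - s) ≤ B ω / (1 - s) := by
    refine div_le_div_of_nonneg_right ?_ (sub_pos.2 hs).le
    exact mul_le_of_le_one_right hB0 (pow_le_one₀ hs0 hs.le)
  have h2 := abs_add_le (Sn α N n ω - S α N ω) (S α N ω)
  rw [sub_add_cancel] at h2
  rw [Real.norm_eq_abs]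
  linarith

/-- Fatou's lemma; the means converge too, so the centred variables converge almost surely. -/
lemma lintegral_exp_S_le (hN : ∀ ϑ, Measurable (N ϑ))
    (hlaw : ∀ ϑ, P.map (N ϑ) = gaussianReal 0 1) (hI : iIndepFun N P)
    (hq : q = (1 / 2 : ℝ) ^ (1 - α / 2)) (hq0 : 0 < q) (hq2 : 2 * q ^ 2 < 1) {c : ℝ}
    (hc : 0 < c) (hqc : q ^ 2 * c + 1 = c) (t : ℝ) :
    ∫⁻ ω, ENNReal.ofReal (Real.exp (t * (S α N ω - ∫ ω', S α N ω' ∂P))) ∂P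
      ≤ ENNReal.ofReal (Real.exp (c * t ^ 2 / 2)) := by
  have hlim := (memLp_S_and_tendsto_integral hN hlaw hq hq0 hq2).2
  have hae : ∀ᵐ ω ∂P, ENNReal.ofReal (Real.exp (t * (S α N ω - ∫ ω', S α N ω' ∂P)))
      = liminf (fun n => ENNReal.ofReal (Real.exp
        (t * (Sn α N n ω - ∫ ω', Sn α N n ω' ∂P)))) atTop := by
    filter_upwards [ae_tendsto_Sn hN hlaw hq hq0 hq2] with ω hω
    refine (Tendsto.liminf_eq (ENNReal.tendsto_ofReal ?_)).symm
    exact (Real.continuous_exp.tendsto _).comp ((hω.sub hlim).const_mul t)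
  rw [lintegral_congr_ae hae]
  refine (lintegral_liminf_le fun n => ?_).trans ?_
  · have := measurable_Sn hN hq hq0 n
    fun_prop
  · have hle : ∀ n, ∫⁻ ω, ENNReal.ofReal (Real.exp
        (t * (Sn α N n ω - ∫ ω', Sn α N n ω' ∂P))) ∂P
        ≤ ENNReal.ofReal (Real.exp (c * t ^ 2 / 2)) := by
      intro n
      rw [Sn_eq_treeMax hq hq0.le]
      exact lintegral_exp_treeMax_le hN hlaw hI hq0 hc hqc n [] t
    exact (liminf_le_liminf (Eventually.of_forall hle)).trans (le_of_eq (liminf_const _))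

/-- The point 0 always falls in the left half, so the value there is a sum of independent normals
q^k N_{ϑ0^k}. -/
lemma map_approxProcess_zero (hN : ∀ ϑ, Measurable (N ϑ))
    (hlaw : ∀ ϑ, P.map (N ϑ) = gaussianReal 0 1) (hI : iIndepFun N P)
    (hq : q = (1 / 2 : ℝ) ^ (1 - α / 2)) (n : ℕ) :
    ∀ ϑ, P.map (fun ω => approxProcess α N n ϑ ω 0)
      = gaussianReal 0 (∑ k ∈ Finset.range n, NNReal.mk (q ^ 2) (sq_nonneg q) ^ k) := by
  induction n with
  | zero =>
    intro ϑ
    rw [Finset.sum_range_zero, gaussianReal_zero_var]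
    simp [approxProcess]
  | succ n ih =>
    intro ϑ
    have e : (fun ω => approxProcess α N (n + 1) ϑ ω 0)
        = (fun ω => q * approxProcess α N n (ϑ ++ [false]) ω 0) + N ϑ := by
      ext ω
      rw [approxProcess_succ hq, if_pos (by norm_num), mul_zero]
      rfl
    have hm := measurable_approxProcess_zero (N := N) hq n (ϑ ++ [false])
    have hm' := hm.mono (nodeSigma_le hN _) le_rfl
    have hind : IndepFun (fun ω => q * approxProcess α N n (ϑ ++ [false]) ω 0) (N ϑ) P :=
      indepFun_of_disjoint hN hI (Set.disjoint_singleton_right.2 (notMem_subtree_child ϑ false))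
        (hm.const_mul q) (measurable_nodeSigma N (Set.mem_singleton ϑ))
    have h1 : P.map (fun ω => q * approxProcess α N n (ϑ ++ [false]) ω 0)
        = gaussianReal (q * 0) (NNReal.mk (q ^ 2) (sq_nonneg q)
          * ∑ k ∈ Finset.range n, NNReal.mk (q ^ 2) (sq_nonneg q) ^ k) := by
      rw [← gaussianReal_map_const_mul, ← ih (ϑ ++ [false]),
        Measure.map_map (measurable_const_mul q) hm']
      rfl
    rw [e, gaussianReal_add_gaussianReal_of_indepFun hind h1 (hlaw ϑ)]
    congr 1
    · simp
    · rw [Finset.sum_range_succ', Finset.mul_sum, pow_zero]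
      congr 1
      exact Finset.sum_congr rfl fun k _ => (pow_succ' _ _).symm

lemma map_eq_gaussianReal_of_tendsto {X : ℕ → Ω → ℝ} {Y : Ω → ℝ} {v : ℕ → ℝ≥0} {v' : ℝ≥0}
    (hX : ∀ n, Measurable (X n)) (hXlaw : ∀ n, P.map (X n) = gaussianReal 0 (v n))
    (hXY : ∀ᵐ ω ∂P, Tendsto (fun n => X n ω) atTop (𝓝 (Y ω)))
    (hv : Tendsto v atTop (𝓝 v')) : P.map Y = gaussianReal 0 v' := by
  have hY : AEMeasurable Y P :=
    aemeasurable_of_tendsto_metrizable_ae atTop (fun n => (hX n).aemeasurable) hXY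
  have := Measure.isProbabilityMeasure_map (μ := P) hY
  refine Measure.ext_of_charFun (funext fun t => ?_)
  have h1 : Tendsto (fun n => charFun (P.map (X n)) t) atTop (𝓝 (charFun (P.map Y) t)) := by
    simp_rw [charFun_apply_real]
    rw [integral_map hY (by fun_prop)]
    simp_rw [fun n => integral_map (μ := P) (hX n).aemeasurable
      (f := fun x : ℝ => Complex.exp (t * x * Complex.I)) (by fun_prop)]
    refine tendsto_integral_of_dominated_convergence (fun _ => 1) (fun n => ?_)
      (integrable_const 1) (fun n => Eventually.of_forall fun ω => ?_) ?_
    · have := hX n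
      exact Measurable.aestronglyMeasurable (by fun_prop)
    · rw [← Complex.ofReal_mul, Complex.norm_exp_ofReal_mul_I]
    · filter_upwards [hXY] with ω hω
      have hc : Continuous fun x : ℝ => Complex.exp (t * x * Complex.I) := by fun_prop
      exact (hc.tendsto _).comp hω
  have h2 : Tendsto (fun n => charFun (P.map (X n)) t) atTop
      (𝓝 (charFun (gaussianReal 0 v') t)) := by
    simp_rw [hXlaw, charFun_gaussianReal]
    have hc : Continuous fun x : ℝ≥0 =>
        Complex.exp (t * (0 : ℝ) * Complex.I - (x : ℝ) * t ^ 2 / 2) := by fun_prop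
    exact (hc.tendsto _).comp hv
  exact tendsto_nhds_unique h1 h2

lemma map_Z_zero (hN : ∀ ϑ, Measurable (N ϑ))
    (hlaw : ∀ ϑ, P.map (N ϑ) = gaussianReal 0 1) (hI : iIndepFun N P)
    (hq : q = (1 / 2 : ℝ) ^ (1 - α / 2)) (hq0 : 0 < q) (hq2 : 2 * q ^ 2 < 1) {v : ℝ≥0}
    (hv : (v : ℝ) = (1 - q ^ 2)⁻¹) :
    P.map (fun ω => Z α N ω 0) = gaussianReal 0 v := by
  obtain ⟨s, B, hs0, hs, _, hB⟩ := exists_memLp_geometric_bound hN hlaw hq0 hq2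
  refine map_eq_gaussianReal_of_tendsto (X := fun n ω => approxProcess α N n [] ω 0)
    (fun n => (measurable_approxProcess_zero hq n []).mono (nodeSigma_le hN _) le_rfl)
    (fun n => map_approxProcess_zero hN hlaw hI hq n []) ?_ ?_
  · filter_upwards [hB] with ω hω
    exact (tendstoUniformlyOn_Zn hq hq0.le hs0 hs hω Set.univ).tendsto_at (Set.mem_univ 0)
  · rw [← NNReal.tendsto_coe, hv]
    simp only [NNReal.coe_sum, NNReal.coe_pow, NNReal.coe_mk]
    exact (hasSum_geometric_of_lt_one (sq_nonneg q) (by nlinarith)).tendsto_sum_nat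

/-- A lower bound for Gaussian tails. -/
lemma le_gaussianReal_Ici {v : ℝ≥0} (hv : v ≠ 0) {x : ℝ} (hx : 0 ≤ x) :
    gaussianPDFReal 0 v (x + 1) ≤ (gaussianReal 0 v).real (Set.Ici x) := by
  rw [Measure.real, gaussianReal_apply_eq_integral _ hv, ENNReal.toReal_ofReal
    (integral_nonneg fun _ => gaussianPDFReal_nonneg _ _ _)]
  have hi := integrable_gaussianPDFReal 0 v
  calc gaussianPDFReal 0 v (x + 1) = ∫ _ in Set.Icc x (x + 1), gaussianPDFReal 0 v (x + 1) := by
        simp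
    _ ≤ ∫ y in Set.Icc x (x + 1), gaussianPDFReal 0 v y := by
        refine setIntegral_mono_on (by simp) hi.integrableOn measurableSet_Icc fun y hy => ?_
        simp only [gaussianPDFReal, sub_zero]
        have h1 : 0 ≤ y := hx.trans hy.1
        have h2 := hy.2
        gcongr
    _ ≤ ∫ y in Set.Ici x, gaussianPDFReal 0 v y :=
        setIntegral_mono_set hi.integrableOn
          (Eventually.of_forall fun _ => gaussianPDFReal_nonneg _ _ _)
          (Eventually.of_forall fun _ hy => hy.1)

/-- S ≥ Z(0), so the upper tail of S dominates a normal tail of variance 1/(1 - q²). -/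
lemma gaussianPDFReal_le_tail_S (hN : ∀ ϑ, Measurable (N ϑ))
    (hlaw : ∀ ϑ, P.map (N ϑ) = gaussianReal 0 1) (hI : iIndepFun N P)
    (hq : q = (1 / 2 : ℝ) ^ (1 - α / 2)) (hq0 : 0 < q) (hq2 : 2 * q ^ 2 < 1) {v : ℝ≥0}
    (hv : (v : ℝ) = (1 - q ^ 2)⁻¹) {m t : ℝ} (hmt : 0 ≤ m + t) :
    gaussianPDFReal 0 v (m + t + 1) ≤ P.real {ω | t ≤ |S α N ω - m|} := by
  have hv0 : v ≠ 0 := by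
    intro h
    rw [h, NNReal.coe_zero] at hv
    have : (1 - q ^ 2)⁻¹ > 0 := inv_pos.2 (by nlinarith)
    linarith
  refine (le_gaussianReal_Ici hv0 hmt).trans ?_
  have hlawZ := map_Z_zero hN hlaw hI hq hq0 hq2 hv
  have hZm : AEMeasurable (fun ω => Z α N ω 0) P := by
    -- The image measure of a function that is not almost everywhere measurable is 0 by convention.
    apply AEMeasurable.of_map_ne_zero
    rw [hlawZ]
    exact NeZero.ne _
  rw [← hlawZ, Measure.real, Measure.map_apply_of_aemeasurable hZm measurableSet_Ici]
  obtain ⟨s, B, hs0, hs, _, hB⟩ := exists_memLp_geometric_bound hN hlaw hq0 hq2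
  refine ENNReal.toReal_mono (measure_ne_top _ _) (measure_mono_ae ?_)
  filter_upwards [hB] with ω hω hZ
  have h1 : m + t ≤ Z α N ω 0 := hZ
  have h2 := Z_le_S hq hq0.le hs hω (t := 0) (by simp)
  exact le_trans (by linarith) (le_abs_self (S α N ω - m))

end Limit

/-! ### Logarithmic asymptotics and numerical constants -/

lemma tendsto_const_add_sq_mul_div_sq (b m a : ℝ) :
    Tendsto (fun t : ℝ => (b - a * (m + t) ^ 2) / t ^ 2) atTop (𝓝 (-a)) := by
  have h1 : Tendsto (fun t : ℝ => b * (t⁻¹) ^ 2 - a * (m * t⁻¹ + 1) ^ 2) atTop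
      (𝓝 (b * 0 ^ 2 - a * (m * 0 + 1) ^ 2)) := by
    have h := tendsto_inv_atTop_zero (𝕜 := ℝ)
    exact ((h.pow 2).const_mul b).sub ((((h.const_mul m).add_const 1).pow 2).const_mul a)
  have e : b * 0 ^ 2 - a * (m * 0 + 1) ^ 2 = -a := by ring
  rw [e] at h1
  refine h1.congr' ?_
  filter_upwards [eventually_gt_atTop 0] with t ht
  field_simp

/-- Both bounds have logarithm b - (m' + t)²/(2v) for constants b, m', which after division by t² do
not affect the limit. -/
lemma tendsto_log_div_sq {f : ℝ → ℝ} {v : ℝ≥0} (hv : v ≠ 0) {m : ℝ}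
    (hlow : ∀ t, 0 ≤ m + t → gaussianPDFReal 0 v (m + t + 1) ≤ f t)
    (hup : ∀ t, 0 < t → f t ≤ 2 * Real.exp (-((2 * (v : ℝ))⁻¹ * t ^ 2))) :
    Tendsto (fun t => Real.log (f t) / t ^ 2) atTop (𝓝 (-(2 * (v : ℝ))⁻¹)) := by
  have hv' : (0 : ℝ) < v := by positivity
  refine tendsto_of_tendsto_of_tendsto_of_le_of_le'
    (tendsto_const_add_sq_mul_div_sq (Real.log (Real.sqrt (2 * Real.pi * v))⁻¹) (m + 1) _)
    (tendsto_const_add_sq_mul_div_sq (Real.log 2) 0 _) ?_ ?_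
  · filter_upwards [eventually_gt_atTop 0, eventually_ge_atTop (-m)] with t ht htm
    refine div_le_div_of_nonneg_right ?_ (sq_nonneg t)
    have h := Real.log_le_log (gaussianPDFReal_pos 0 v _ hv) (hlow t (by linarith))
    refine le_trans (le_of_eq ?_) h
    rw [gaussianPDFReal, Real.log_mul (by positivity) (Real.exp_pos _).ne', Real.log_exp]
    field_simp
    ring
  · filter_upwards [eventually_gt_atTop 0, eventually_ge_atTop (-m)] with t ht htm
    refine div_le_div_of_nonneg_right ?_ (sq_nonneg t)
    have hpos := (gaussianPDFReal_pos 0 v (m + t + 1) hv).trans_le (hlow t (by linarith))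
    have h := Real.log_le_log hpos (hup t ht)
    refine h.trans (le_of_eq ?_)
    rw [Real.log_mul two_ne_zero (Real.exp_pos _).ne', Real.log_exp]
    ring

lemma kappa_eq_sq (α : ℝ) : kappa α = ((1 / 2 : ℝ) ^ (1 - α / 2)) ^ 2 := by
  rw [kappa, ← Real.rpow_natCast, ← Real.rpow_mul (by norm_num)]
  congr 1
  push_cast
  ring

lemma two_mul_kappa_lt_one {α : ℝ} (hα : α ≤ 1 / 2) : 2 * kappa α < 1 := by
  have h : kappa α < (1 / 2 : ℝ) ^ (1 : ℝ) :=
    Real.rpow_lt_rpow_of_exponent_gt (by norm_num) (by norm_num) (by linarith)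
  rw [Real.rpow_one] at h
  linarith

/-- The square of κ = 2^(-3/2) is rational, so decimal enclosures of κ and √κ follow by squaring. -/
lemma kappa_half_sq : kappa (1 / 2) ^ 2 = 1 / 8 := by
  rw [kappa, ← Real.rpow_natCast, ← Real.rpow_mul (by norm_num),
    show (2 - 1 / 2 : ℝ) * (2 : ℕ) = (3 : ℕ) by norm_num, Real.rpow_natCast]
  norm_num

lemma mean_bounds_half :
    Real.sqrt 2 / (Real.sqrt Real.pi * (1 - Real.sqrt (kappa (1 / 2))))
      ∈ Set.Ico (1.968 : ℝ) 1.969 ∧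
    Real.sqrt (2 / (1 - 2 * kappa (1 / 2))) ∈ Set.Ico (2.613 : ℝ) 2.614 := by
  have hk := kappa_half_sq
  have hk0 : 0 < kappa (1 / 2) := by rw [kappa]; positivity
  set k := kappa (1 / 2) with hkdef
  have hkl : 0.353553 < k := by nlinarith
  have hku : k < 0.353554 := by nlinarith
  set r := Real.sqrt k with hr
  have hr0 : 0 ≤ r := Real.sqrt_nonneg _
  have hr2 : r ^ 2 = k := Real.sq_sqrt hk0.le
  have hrl : 0.594602 < r := by nlinarith
  have hru : r < 0.594605 := by nlinarith
  have hp0 : 0 ≤ Real.sqrt Real.pi := Real.sqrt_nonneg _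
  have hp2 : Real.sqrt Real.pi ^ 2 = Real.pi := Real.sq_sqrt Real.pi_pos.le
  have hpl := Real.pi_gt_d6
  have hpu := Real.pi_lt_d6
  have hpl' : 1.77245 < Real.sqrt Real.pi := by nlinarith
  have hpu' : Real.sqrt Real.pi < 1.77246 := by nlinarith
  have h20 : 0 ≤ Real.sqrt 2 := Real.sqrt_nonneg _
  have h22 : Real.sqrt 2 ^ 2 = 2 := Real.sq_sqrt zero_le_two
  have h2l : 1.414213 < Real.sqrt 2 := by nlinarith
  have h2u : Real.sqrt 2 < 1.414214 := by nlinarith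
  have hden : 0 < Real.sqrt Real.pi * (1 - r) := mul_pos (by linarith) (by linarith)
  refine ⟨⟨?_, ?_⟩, ?_, ?_⟩
  · rw [le_div_iff₀ hden]
    have : Real.sqrt Real.pi * (1 - r) ≤ 1.77246 * (1 - 0.594602) :=
      mul_le_mul hpu'.le (by linarith) (by linarith) (by norm_num)
    linarith
  · rw [div_lt_iff₀ hden]
    have : 1.77245 * (1 - 0.594605) ≤ Real.sqrt Real.pi * (1 - r) :=
      mul_le_mul hpl'.le (by linarith) (by norm_num) hp0
    linarith
  · rw [Real.le_sqrt (by norm_num) (by have : 0 < 1 - 2 * k := by linarith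
                                       positivity), le_div_iff₀ (by linarith)]
    linarith
  · rw [Real.sqrt_lt' (by norm_num), div_lt_iff₀ (by linarith)]
    linarith

end MedianFind

/-! ### Assembly of the theorem -/

theorem mainTheorem9 {Ω : Type*} [MeasurableSpace Ω] (P : MeasureTheory.Measure Ω)
    [MeasureTheory.IsProbabilityMeasure P]
    (α : ℝ) (hα₀ : 0 < α) (hα₁ : α ≤ 1 / 2)
    (N : List Bool → Ω → ℝ)
    (hN_meas : ∀ ϑ, Measurable (N ϑ))
    (hN_law : ∀ ϑ, P.map (N ϑ) = ProbabilityTheory.gaussianReal 0 1)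
    (hN_indep : ProbabilityTheory.iIndepFun N P) :
    -- the limit process is well defined: almost surely, `Z_n → Z` uniformly on `[0, 1]`
    (∀ᵐ ω ∂P, TendstoUniformlyOn (fun n t => MedianFind.Zn α N n ω t) (MedianFind.Z α N ω)
      Filter.atTop (Set.Icc 0 1)) ∧
    -- the suprema are square integrable (so means and variance are meaningful)
    MeasureTheory.MemLp (MedianFind.S α N) 2 P ∧
    (∀ n, MeasureTheory.MemLp (MedianFind.Sn α N n) 2 P) ∧
    -- tail bound for `S`
    (∀ t : ℝ, 0 < t →
      P.real {ω | t ≤ |MedianFind.S α N ω - ∫ ω', MedianFind.S α N ω' ∂P|}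
        ≤ 2 * Real.exp (-((1 - MedianFind.kappa α) / 2 * t ^ 2))) ∧
    -- tail bound for `S_n`
    (∀ (n : ℕ) (t : ℝ), 0 < t →
      P.real {ω | t ≤ |MedianFind.Sn α N n ω - ∫ ω', MedianFind.Sn α N n ω' ∂P|}
        ≤ 2 * Real.exp (-((1 - MedianFind.kappa α) / 2 * t ^ 2))) ∧
    -- asymptotic optimality of the constant in the exponent
    Filter.Tendsto
      (fun t : ℝ =>
        Real.log (P.real {ω | t ≤ |MedianFind.S α N ω - ∫ ω', MedianFind.S α N ω' ∂P|}) / t ^ 2)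
      Filter.atTop (nhds (-((1 - MedianFind.kappa α) / 2))) ∧
    -- bounds on the mean
    Real.sqrt 2 / (Real.sqrt Real.pi * (1 - Real.sqrt (MedianFind.kappa α)))
      ≤ ∫ ω, MedianFind.S α N ω ∂P ∧
    ∫ ω, MedianFind.S α N ω ∂P ≤ Real.sqrt (2 / (1 - 2 * MedianFind.kappa α)) ∧
    -- bound on the variance
    ProbabilityTheory.variance (MedianFind.S α N) P ≤ 1 / (1 - MedianFind.kappa α) ∧
    -- numerical values of the bounds on the mean for `α = 1/2`
    (α = 1 / 2 →
      Real.sqrt 2 / (Real.sqrt Real.pi * (1 - Real.sqrt (MedianFind.kappa α)))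
        ∈ Set.Ico (1.968 : ℝ) 1.969 ∧
      Real.sqrt (2 / (1 - 2 * MedianFind.kappa α)) ∈ Set.Ico (2.613 : ℝ) 2.614) := by
  set q : ℝ := (1 / 2 : ℝ) ^ (1 - α / 2) with hq
  have hq0 : 0 < q := by positivity
  have hκ : MedianFind.kappa α = q ^ 2 := MedianFind.kappa_eq_sq α
  have hq2 : 2 * q ^ 2 < 1 := hκ ▸ MedianFind.two_mul_kappa_lt_one hα₁
  have hsqrt : Real.sqrt (MedianFind.kappa α) = q := by rw [hκ, Real.sqrt_sq hq0.le]
  have hden : 0 < 1 - q ^ 2 := by nlinarith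
  have hc : 0 < (1 - q ^ 2)⁻¹ := inv_pos.2 hden
  have hqc : q ^ 2 * (1 - q ^ 2)⁻¹ + 1 = (1 - q ^ 2)⁻¹ := by
    field_simp
    ring
  set v : NNReal := ⟨(1 - q ^ 2)⁻¹, hc.le⟩ with hv
  have hvc : (v : ℝ) = (1 - q ^ 2)⁻¹ := rfl
  have hv0 : v ≠ 0 := fun h => hc.ne' (by rw [← hvc, h, NNReal.coe_zero])
  obtain ⟨hS, hlim⟩ := MedianFind.memLp_S_and_tendsto_integral hN_meas hN_law hq hq0 hq2
  have hSn : ∀ n, MedianFind.Sn α N n = MedianFind.treeMax q N n [] :=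
    MedianFind.Sn_eq_treeMax hq hq0.le
  have h2 := fun n =>
    MedianFind.memLp_treeMax_and_integral_sq_le hN_meas hN_law hN_indep hq2 n []
  have hsub : ProbabilityTheory.HasSubgaussianMGF
      (fun ω => MedianFind.S α N ω - ∫ ω', MedianFind.S α N ω' ∂P) v P :=
    MedianFind.hasSubgaussianMGF_of_lintegral_exp_le (hS.aemeasurable.sub_const _) fun t =>
      MedianFind.lintegral_exp_S_le hN_meas hN_law hN_indep hq hq0 hq2 hc hqc t
  have hexp : ∀ t : ℝ, -t ^ 2 / (2 * (v : ℝ)) = -((1 - MedianFind.kappa α) / 2 * t ^ 2) := by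
    intro t
    rw [hvc, hκ]
    field_simp
  have htail : ∀ t : ℝ, 0 < t →
      P.real {ω | t ≤ |MedianFind.S α N ω - ∫ ω', MedianFind.S α N ω' ∂P|}
        ≤ 2 * Real.exp (-((1 - MedianFind.kappa α) / 2 * t ^ 2)) := fun t ht =>
    hexp t ▸ MedianFind.measure_abs_ge_le_of_hasSubgaussianMGF hsub ht.le
  refine ⟨?_, hS, fun n => hSn n ▸ (h2 n).1, htail, fun n t ht => ?_, ?_, ?_, ?_, ?_, ?_⟩
  · obtain ⟨s, B, hs0, hs, _, hB⟩ :=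
      MedianFind.exists_memLp_geometric_bound hN_meas hN_law hq0 hq2
    filter_upwards [hB] with ω hω
    exact MedianFind.tendstoUniformlyOn_Zn hq hq0.le hs0 hs hω _
  · rw [← hexp, hSn]
    exact MedianFind.measure_abs_ge_le_of_hasSubgaussianMGF
      (MedianFind.hasSubgaussianMGF_of_lintegral_exp_le (c := v)
        ((h2 n).1.aemeasurable.sub_const _) fun t =>
          MedianFind.lintegral_exp_treeMax_le hN_meas hN_law hN_indep hq0 hc hqc n [] t) ht.le
  · have hconst : (1 - MedianFind.kappa α) / 2 = (2 * (v : ℝ))⁻¹ := by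
      rw [hvc, hκ]
      field_simp
    rw [hconst]
    exact MedianFind.tendsto_log_div_sq hv0 (fun t hmt =>
      MedianFind.gaussianPDFReal_le_tail_S hN_meas hN_law hN_indep hq hq0 hq2 hvc hmt)
      fun t ht => hconst ▸ htail t ht
  · have hq1 : q < 1 := by nlinarith
    have hgeo := ((hasSum_geometric_of_lt_one hq0.le hq1).tendsto_sum_nat).const_mul
      (Real.sqrt (2 / Real.pi))
    have hle := le_of_tendsto_of_tendsto' hgeo hlim fun n => hSn n ▸
      MedianFind.le_integral_treeMax hN_meas hN_law hN_indep hq0 hq2 n []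
    rw [hsqrt]
    refine le_trans (le_of_eq ?_) hle
    rw [Real.sqrt_div zero_le_two, ← div_eq_mul_inv, div_div]
  · refine le_of_tendsto' hlim fun n => Real.le_sqrt_of_sq_le ?_
    rw [hSn, hκ]
    refine le_trans ?_ (h2 n).2
    -- Nonnegativity of the variance gives (E S_n)² ≤ E S_n².
    have hvar := ProbabilityTheory.variance_nonneg (MedianFind.treeMax q N n []) P
    rw [ProbabilityTheory.variance_eq_sub (h2 n).1] at hvar
    simpa using hvar
  · rw [ProbabilityTheory.variance_eq_integral hS.aemeasurable, hκ, one_div]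
    exact MedianFind.integral_sq_le_of_hasSubgaussianMGF hsub
  · rintro rfl
    exact MedianFind.mean_bounds_half
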